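/- Let $\Omega\subset\mathbb R^d$ be open and bounded with $\mathscr L^d(\partial\Omega)=0$, let $\mathbb T^d=\mathbb R^d/\mathbb Z^d$ be the flat torus with its Lebesgue measure $d\xi$ (of total mass one), and let $E\neq\{0\}$ be a finite-dimensional Euclidean space with unit sphere $\mathbb S_E$. A *two-scale\* Young measure* on $\Omega$ with values in $E$ is a quadruple $(\nu,\lambda,\rho,\nu^\infty)$ where - $(x,\xi)\mapsto\nu_{x,\xi}$ is a weak-\* measurable map from $\overline\Omega\times\mathbb T^d$ into the probability measures on $E$ such that $\int_{\overline\Omega}\int_{\mathbb T^d}\int_E|z|\,d\nu_{x,\xi}(z)\,d\xi\,dx<\infty$; - $\lambda$ is a finite positive Borel measure on $\overline\Omega$; - $x\mapsto\rho_x$ is a weak-\* $\lambda$-measurable map from $\overline\Omega$ into the probability measures on $\mathbb T^d$; - $(x,\xi)\mapsto\nu^\infty_{x,\xi}$ is a weak-\* $(\lambda\otimes\rho_x)$-measurable map from $\overline\Omega\times\mathbb T^d$ into the probability measures on $\mathbb S_E$. Let $f:\Omega\times\mathbb T^d\times E\to\mathbb R$ be a continuous function whose strong recession function exists, i.e. the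 limit $$f^\infty(x,\xi,z):=\lim_{\substack{\Omega\times\mathbb T^d\times E\ni(x',\xi',z')\to(x,\xi,z)\\ t\to\infty}}\frac{f(x',\xi',tz')}{t}$$ exists in $\mathbb R$ for every $(x,\xi,z)\in\overline\Omega\times\mathbb T^d\times E$. For $\epsilon>0$ and an $E$-valued measure $\mu$ on $\Omega$ with finite total variation and Lebesgue decomposition $\mu=\frac{d\mu}{d\mathscr L^d}\mathscr L^d+\mu^s$, let $f(x,x/\epsilon,\mu)$ denote the finite signed measure $$f\Big(x,\tfrac x\epsilon,\tfrac{d\mu}{d\mathscr L^d}(x)\Big)\mathscr L^d\llcorner\Omega+f^\infty\Big(x,\tfrac x\epsilon,\tfrac{d\mu^s}{d|\mu^s|}(x)\Big)|\mu^s|,$$ regarded as a measure on $\overline\Omega$ (where $x/\epsilon$ is taken modulo $\mathbb Z^d$). **Theorem.** Let $(\epsilon_n)_{n\in\mathbb N}$ be a sequence of positive reals converging to $0$ and let $(\mu_n)_{n\in\mathbb N}$ be $E$-valued Borel measures on $\Omega$ with $\sup_n|\mu_n|(\Omega)<\infty$. Then there exist a strictly increasing sequence of indices $(n_k)_k$ and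 a two-scale\* Young measure $(\nu,\lambda,\rho,\nu^\infty)$ on $\Omega$ with values in $E$ such that, for every continuous $f:\Omega\times\mathbb T^d\times E\to\mathbb R$ whose strong recession function $f^\infty$ exists, the densities defining the measures $f(x,x/\epsilon_{n_k},\mu_{n_k})$ are integrable and there is a finite signed Borel measure $\mu_f$ on $\overline\Omega$ with $$\int_{\overline\Omega}\varphi\,d\big[f(x,x/\epsilon_{n_k},\mu_{n_k})\big]\to\int_{\overline\Omega}\varphi\,d\mu_f\quad(k\to\infty)\qquad\text{for all }\varphi\in C(\overline\Omega),$$ and, for every Borel set $\omega\subset\overline\Omega$, $$\mu_f(\omega)=\int_{\omega\cap\Omega}\int_{\mathbb T^d}\int_E f(x,\xi,z)\,d\nu_{x,\xi}(z)\,d\xi\,dx+\int_{\omega}\int_{\mathbb T^d}\int_{\mathbb S_E}f^\infty(x,\xi,z)\,d\nu^\infty_{x,\xi}(z)\,d\rho_x(\xi)\,d\lambda(x),$$ where all these integrals converge absolutely. The subsequence and the Young measure do not depend on $f$. -/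

import Mathlib

open MeasureTheory ProbabilityTheory Filter Topology Set
open scoped ENNReal

noncomputable section

namespace TwoScale

/-- The flat torus `ℝᵈ / ℤᵈ`; its `volume` is the Lebesgue (Haar) measure, of total mass one. -/
abbrev Torus (d : ℕ) : Type := UnitAddTorus (Fin d)

/-- The class of `x / ε` in the torus. -/
def fastVar {d : ℕ} (ε : ℝ) (x : EuclideanSpace ℝ (Fin d)) : Torus d :=
  fun i => ((x i / ε : ℝ) : UnitAddCircle)

/-- The inclusion of `Ω` into its closure. -/
def incl {d : ℕ} (Ω : Set (EuclideanSpace ℝ (Fin d))) : Ω → closure Ω :=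
  Set.inclusion subset_closure

/-- The restriction of Lebesgue measure to a (Borel) set `S`, as a measure on `S`. -/
def leb {d : ℕ} (S : Set (EuclideanSpace ℝ (Fin d))) : Measure S :=
  (volume : Measure (EuclideanSpace ℝ (Fin d))).comap Subtype.val

section Decomposition

variable {X : Type*} [MeasurableSpace X]
  {E : Type*} [NormedAddCommGroup E] [InnerProductSpace ℝ E] [FiniteDimensional ℝ E]

/-- The component `⟨e, μ(·)⟩` of a vector measure, a finite signed measure. -/
def component (e : E) (μ : VectorMeasure X E) : SignedMeasure X :=
  μ.mapRange (innerSL ℝ e : E →L[ℝ] ℝ).toLinearMap.toAddMonoidHom (innerSL ℝ e).continuous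

/-- The Radon-Nikodym density `dμ/dm` (of the part of `μ` that is absolutely continuous with
respect to `m`), computed componentwise in an orthonormal basis. -/
def density (μ : VectorMeasure X E) (m : Measure X) (x : X) : E :=
  ∑ i, (component (stdOrthonormalBasis ℝ E i) μ).rnDeriv m x • stdOrthonormalBasis ℝ E i

/-- The part `μˢ = μ - (dμ/dm) m` of `μ` that is singular with respect to `m`. -/
def singularPart (μ : VectorMeasure X E) (m : Measure X) : VectorMeasure X E :=
  μ - m.withDensityᵥ (density μ m)

/-- The total variation measure `|μˢ|` of the singular part. -/
def singularVariation (μ : VectorMeasure X E) (m : Measure X) : Measure X :=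
  (singularPart μ m).variation

/-- The polar density `dμˢ/d|μˢ|` of the singular part. -/
def singularPolar (μ : VectorMeasure X E) (m : Measure X) : X → E :=
  density (singularPart μ m) (singularVariation μ m)

end Decomposition

section Integrands

variable {d : ℕ} {Ω : Set (EuclideanSpace ℝ (Fin d))}
  {E : Type*} [NormedAddCommGroup E] [InnerProductSpace ℝ E]

/-- `finf` is the strong recession function of `f`: for all `(x, ξ, z)` with `x` in the closure of
`Ω`, the limit of `f (x', ξ', t z') / t` as `Ω ∋ x' → x`, `ξ' → ξ`, `z' → z`, `t → ∞` exists and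
equals `finf (x, ξ, z)`. -/
def IsRecession (f : Ω × Torus d × E → ℝ) (finf : closure Ω × Torus d × E → ℝ) : Prop :=
  ∀ (x : closure Ω) (ξ : Torus d) (z : E),
    Tendsto (fun q : (Ω × Torus d × E) × ℝ => f (q.1.1, q.1.2.1, q.2 • q.1.2.2) / q.2)
      ((comap (fun y : Ω => (y : EuclideanSpace ℝ (Fin d))) (𝓝 (x : EuclideanSpace ℝ (Fin d)))
          ×ˢ 𝓝 ξ ×ˢ 𝓝 z) ×ˢ atTop)
      (𝓝 (finf (x, ξ, z)))

variable [FiniteDimensional ℝ E]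

/-- The density of the absolutely continuous part of `f(x, x/ε, μ)` with respect to Lebesgue
measure. -/
def acIntegrand (f : Ω × Torus d × E → ℝ) (ε : ℝ) (μ : VectorMeasure Ω E) (x : Ω) : ℝ :=
  f (x, fastVar ε (x : EuclideanSpace ℝ (Fin d)), density μ (leb Ω) x)

/-- The density of the singular part of `f(x, x/ε, μ)` with respect to `|μˢ|`. -/
def singIntegrand (finf : closure Ω × Torus d × E → ℝ) (ε : ℝ) (μ : VectorMeasure Ω E)
    (x : Ω) : ℝ :=
  finf (incl Ω x, fastVar ε (x : EuclideanSpace ℝ (Fin d)), singularPolar μ (leb Ω) x)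

/-- The measure `f(x, x/ε, μ)`, that is
`f(x, x/ε, dμ/dx) dx + f^∞(x, x/ε, dμˢ/d|μˢ|) |μˢ|` on `Ω`, seen as a measure on the closure. -/
def composition (f : Ω × Torus d × E → ℝ) (finf : closure Ω × Torus d × E → ℝ) (ε : ℝ)
    (μ : VectorMeasure Ω E) : SignedMeasure (closure Ω) :=
  ((leb Ω).withDensityᵥ (acIntegrand f ε μ) +
    (singularVariation μ (leb Ω)).withDensityᵥ (singIntegrand finf ε μ)).map (incl Ω)

end Integrands

/-- Weak-* convergence of finite signed measures on a compact space. -/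
def WeakStarTendsto {K : Type*} [TopologicalSpace K] [MeasurableSpace K]
    (m : ℕ → SignedMeasure K) (m₀ : SignedMeasure K) : Prop :=
  ∀ φ : C(K, ℝ), Tendsto (fun n => ∫ᵛ x, φ x ∂•(m n)) atTop (𝓝 (∫ᵛ x, φ x ∂•m₀))

/-- Two-scale* Young measures `(ν, λ, ρ, ν^∞)` on `Ω` with values in `E`. Weak-* measurable families
of probability measures are Markov kernels: a family that is weak-* measurable with respect to the
completion of a finite measure coincides almost everywhere with such a kernel. -/
structure YoungMeasure {d : ℕ} (Ω : Set (EuclideanSpace ℝ (Fin d))) (E : Type*)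
    [NormedAddCommGroup E] [InnerProductSpace ℝ E] [MeasurableSpace E] where
  /-- the oscillation measures `ν_{x,ξ}`, probability measures on `E` -/
  osc : Kernel (closure Ω × Torus d) E
  osc_prob : IsMarkovKernel osc
  /-- the map `(x, ξ) ↦ ⟨ν_{x,ξ}, |·|⟩` is Lebesgue integrable -/
  osc_moment : ∫⁻ p, ∫⁻ z, ‖z‖ₑ ∂(osc p)
    ∂((leb (closure Ω)).prod (volume : Measure (Torus d))) < ∞
  /-- the concentration measure `λ` -/
  conc : Measure (closure Ω)
  conc_finite : IsFiniteMeasure conc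
  /-- the second-scale concentration measures `ρ_x`, probability measures on the torus -/
  rho : Kernel (closure Ω) (Torus d)
  rho_prob : IsMarkovKernel rho
  /-- the concentration-angle measures `ν^∞_{x,ξ}`, probability measures on the unit sphere -/
  ang : Kernel (closure Ω × Torus d) (Metric.sphere (0 : E) 1)
  ang_prob : IsMarkovKernel ang

section Pairing

variable {d : ℕ} {Ω : Set (EuclideanSpace ℝ (Fin d))}
  {E : Type*} [NormedAddCommGroup E] [InnerProductSpace ℝ E] [MeasurableSpace E]

/-- The family `ν_{x,ξ}` for `x ∈ Ω`. -/
def YoungMeasure.oscInterior (Y : YoungMeasure Ω E) : Kernel (Ω × Torus d) E :=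
  Y.osc.comap (fun p => (incl Ω p.1, p.2))
    (((measurable_inclusion subset_closure).comp measurable_fst).prodMk measurable_snd)

/-- The oscillation integral `∫_{ω ∩ Ω} ∫ ∫ f(x, ξ, z) dν_{x,ξ}(z) dξ dx`. -/
def oscPart (Y : YoungMeasure Ω E) (f : Ω × Torus d × E → ℝ) (ω : Set (closure Ω)) : ℝ :=
  ∫ x in incl Ω ⁻¹' ω, ∫ ξ : Torus d, ∫ z, f (x, ξ, z) ∂(Y.oscInterior (x, ξ)) ∂volume ∂(leb Ω)

/-- The concentration integral `∫_ω ∫ ∫ f^∞(x, ξ, z) dν^∞_{x,ξ}(z) dρ_x(ξ) dλ(x)`. -/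
def concPart (Y : YoungMeasure Ω E) (finf : closure Ω × Torus d × E → ℝ)
    (ω : Set (closure Ω)) : ℝ :=
  ∫ x in ω, ∫ ξ, ∫ z, finf (x, ξ, (z : E)) ∂(Y.ang (x, ξ)) ∂(Y.rho x) ∂Y.conc

/-- All integrals in the representation formula converge absolutely. -/
def PairingIntegrable (Y : YoungMeasure Ω E) (f : Ω × Torus d × E → ℝ)
    (finf : closure Ω × Torus d × E → ℝ) : Prop :=
  Integrable (fun q : (Ω × Torus d) × E => f (q.1.1, q.1.2, q.2))
      (((leb Ω).prod (volume : Measure (Torus d))) ⊗ₘ Y.oscInterior) ∧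
    Integrable (fun q : (closure Ω × Torus d) × Metric.sphere (0 : E) 1 =>
        finf (q.1.1, q.1.2, (q.2 : E)))
      ((Y.conc ⊗ₘ Y.rho) ⊗ₘ Y.ang)

end Pairing

end TwoScale

end

/-! The target `E` is compactified to the closed unit ball by `z ↦ z / (1 + |z|)`, the sphere
standing for directions at infinity. An integrand `f` becomes the bounded function `Tf(x, ξ, w) = (1
- |w|) f(x, ξ, w / (1 - |w|))` inside the ball and `f^∞` on the sphere (`ballTransform`). A measure
`μ` with density `a` and singular polar density `p` becomes a positive measure on `closure Ω × 𝕋 ×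
ball`: the image of `(1 + |a|) dx` under `x ↦ (x, x/ε, a / (1 + |a|))` plus the image of `|p| |μˢ|`
under `x ↦ (x, x/ε, p / |p|)`. Pairing `f(x, x/ε, μ)` with `φ` is then integrating `φ · Tf` against
this lift (`integral_composition`). The lifts have bounded mass on a compact space, so a subsequence
converges weakly-* to some `θ`, chosen before any `f`.

The Young measure is read off `θ`. Weighted by `1 - |w|` and pulled back to `E`, its part inside the
ball disintegrates into `ν`; its part on the sphere disintegrates into `λ`, `ρ`, `ν^∞`. That `ν` is
a family of probabilities over `dx dξ` means that the first marginal of the weighted part is `dx ⊗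
dξ` (`fst_oscMeasure_eq_prod`). This holds because the weight cancels `1 + |a|` and kills the
singular lift, leaving the equidistribution of `x/ε`, a consequence of the Riemann-Lebesgue lemma.

The remaining difficulty is that `f` need not extend continuously to the boundary of `Ω`, so `Tf`
need not be continuous. Extended there by `f^∞`, it is continuous at interior points and, by the
strong form of the recession limit, at every point of the sphere. The exceptional set, boundary
points with `|w| < 1`, is `θ`-null by the marginal identity and `|∂Ω| = 0`
(`ae_mem_or_norm_eq_one`). Weak convergence therefore still passes to `Tf`
(`tendsto_integral_of_ae_continuousAt`). -/

namespace TwoScale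

/-! ### Integrals against signed measures given by a density. -/

section WithDensity

variable {Y X : Type*} [MeasurableSpace Y] [MeasurableSpace X]

lemma integral_toSignedMeasure_real {m : Measure Y} [IsFiniteMeasure m] (φ : Y → ℝ) :
    ∫ᵛ x, φ x ∂•m.toSignedMeasure = ∫ x, φ x ∂m := by
  rw [← VectorMeasure.integral_toSignedMeasure]
  congr 1
  ext
  simp

lemma integrable_withDensityᵥ {m : Measure Y} {g φ : Y → ℝ} (hg : Integrable g m)
    (hφ : Measurable φ) {C : ℝ} (hC : ∀ x, |φ x| ≤ C) :
    (m.withDensityᵥ g).Integrable φ := by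
  have : IsFiniteMeasure (m.withDensityᵥ g).variation := by
    rw [Measure.variation_withDensityᵥ hg]
    exact isFiniteMeasure_withDensity hg.2.ne
  exact Integrable.of_bound hφ.aestronglyMeasurable C (Eventually.of_forall hC)

lemma integral_withDensityᵥ {m : Measure Y} {g φ : Y → ℝ} (hg : Integrable g m)
    (hφ : Measurable φ) {C : ℝ} (hC : ∀ x, |φ x| ≤ C) :
    ∫ᵛ x, φ x ∂•(m.withDensityᵥ g) = ∫ x, φ x * g x ∂m := by
  have h1 : IsFiniteMeasure (m.withDensity fun x => ENNReal.ofReal (g x)) :=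
    isFiniteMeasure_withDensity_ofReal hg.2
  have h2 : IsFiniteMeasure (m.withDensity fun x => ENNReal.ofReal (-g x)) :=
    isFiniteMeasure_withDensity_ofReal hg.neg.2
  have hb (ν : Measure Y) [IsFiniteMeasure ν] : ν.toSignedMeasure.Integrable φ := by
    rw [VectorMeasure.Integrable, Measure.variation_toSignedMeasure]
    exact Integrable.of_bound hφ.aestronglyMeasurable C (Eventually.of_forall hC)
  have key {h : Y → ℝ} (hh : Integrable h m) :
      ∫ x, φ x ∂(m.withDensity fun x => ENNReal.ofReal (h x)) = ∫ x, max (h x) 0 * φ x ∂m := by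
    rw [integral_withDensity_eq_integral_toReal_smul₀
      hh.aestronglyMeasurable.aemeasurable.ennreal_ofReal
      (Eventually.of_forall fun _ => ENNReal.ofReal_lt_top)]
    simp [ENNReal.toReal_ofReal']
  have hi {h : Y → ℝ} (hh : Integrable h m) : Integrable (fun x => max (h x) 0 * φ x) m :=
    hh.pos_part.mul_bdd (c := C) hφ.aestronglyMeasurable (Eventually.of_forall hC)
  have hn : Integrable (fun x => -g x) m := hg.neg
  rw [withDensityᵥ_eq_withDensity_pos_part_sub_withDensity_neg_part hg,
    VectorMeasure.integral_sub_vectorMeasure (hb _) (hb _), integral_toSignedMeasure_real,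
    integral_toSignedMeasure_real, key hg, key hn, ← integral_sub (hi hg) (hi hn)]
  refine integral_congr_ae (Eventually.of_forall fun x => ?_)
  dsimp only
  rw [← sub_mul, max_zero_sub_max_neg_zero_eq_self, mul_comm]

lemma integral_map_withDensityᵥ {m : Measure Y} {g : Y → ℝ} {φ : X → ℝ} {ψ : Y → X}
    (hg : Integrable g m) (hψ : Measurable ψ) (hφ : Measurable φ) {C : ℝ} (hC : ∀ x, |φ x| ≤ C) :
    ∫ᵛ x, φ x ∂•((m.withDensityᵥ g).map ψ) = ∫ y, φ (ψ y) * g y ∂m := by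
  rw [VectorMeasure.integral_map hψ hφ.aestronglyMeasurable
    (integrable_withDensityᵥ hg (hφ.comp hψ) fun x => hC _)]
  exact integral_withDensityᵥ hg (hφ.comp hψ) fun x => hC _

lemma integral_map_withDensityᵥ_add {m m' : Measure Y} {g g' : Y → ℝ} {φ : X → ℝ} {ψ : Y → X}
    (hg : Integrable g m) (hg' : Integrable g' m') (hψ : Measurable ψ) (hφ : Measurable φ)
    {C : ℝ} (hC : ∀ x, |φ x| ≤ C) :
    ∫ᵛ x, φ x ∂•((m.withDensityᵥ g + m'.withDensityᵥ g').map ψ) =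
      ∫ y, φ (ψ y) * g y ∂m + ∫ y, φ (ψ y) * g' y ∂m' := by
  have h1 := integrable_withDensityᵥ hg (hφ.comp hψ) fun x => hC _
  have h2 := integrable_withDensityᵥ hg' (hφ.comp hψ) fun x => hC _
  rw [VectorMeasure.integral_map hψ hφ.aestronglyMeasurable (h1.add_vectorMeasure h2),
    VectorMeasure.integral_add_vectorMeasure (f := fun x => φ (ψ x)) h1 h2]
  congr 1
  · exact integral_withDensityᵥ hg (hφ.comp hψ) fun x => hC _
  · exact integral_withDensityᵥ hg' (hφ.comp hψ) fun x => hC _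

end WithDensity

/-! ### Weak compactness and test functions continuous almost everywhere. -/

section WeakConvergence

/-- Sequential weak compactness of bounded sequences of measures on a compact metrizable space. -/
lemma exists_subseq_tendsto_integral {K : Type*} [TopologicalSpace K] [CompactSpace K]
    [TopologicalSpace.MetrizableSpace K] [MeasurableSpace K] [BorelSpace K]
    (θ : ℕ → Measure K) [∀ n, IsFiniteMeasure (θ n)] {C : ℝ} (hC : ∀ n, (θ n).real univ ≤ C) :
    ∃ (k : ℕ → ℕ) (η : Measure K), StrictMono k ∧ IsFiniteMeasure η ∧
      ∀ φ : C(K, ℝ), Tendsto (fun n => ∫ x, φ x ∂(θ (k n))) atTop (𝓝 (∫ x, φ x ∂η)) := by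
  rcases isEmpty_or_nonempty K with hK | hK
  · refine ⟨id, 0, strictMono_id, inferInstance, fun φ => ?_⟩
    have (n : ℕ) : θ n = 0 := Measure.eq_zero_of_isEmpty _
    simp [this]
  let F : ℕ → FiniteMeasure K := fun n => ⟨θ n, inferInstance⟩
  -- Masses and normalised measures are made to converge separately. A measure of mass zero has an
  -- arbitrary normalisation, which the mass factor cancels.
  obtain ⟨c, -, k₁, hk₁, hc⟩ := (isCompact_Icc (a := (0 : ℝ)) (b := C)).tendsto_subseq
    (x := fun n => (θ n).real univ) fun n => ⟨measureReal_nonneg, hC n⟩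
  obtain ⟨P, k₂, hk₂, hP⟩ := CompactSpace.tendsto_subseq fun n => (F (k₁ n)).normalize
  have hc0 : 0 ≤ c := ge_of_tendsto' hc fun n => measureReal_nonneg
  refine ⟨k₁ ∘ k₂, c.toNNReal • (P : Measure K), hk₁.comp hk₂, inferInstance, fun φ => ?_⟩
  have h1 := (ProbabilityMeasure.tendsto_iff_forall_integral_tendsto.1 hP)
    (BoundedContinuousFunction.mkOfCompact φ)
  have h2 := (hc.comp hk₂.tendsto_atTop).mul h1
  rw [integral_smul_nnreal_measure, NNReal.smul_def, Real.coe_toNNReal _ hc0, smul_eq_mul]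
  refine h2.congr fun n => ?_
  have h3 := congrArg (fun ν : FiniteMeasure K => (ν : Measure K))
    (F (k₁ (k₂ n))).self_eq_mass_smul_normalize
  have h4 : θ (k₁ (k₂ n)) = (F (k₁ (k₂ n))).mass • ((F (k₁ (k₂ n))).normalize : Measure K) := h3
  simp only [Function.comp_apply]
  conv_rhs => rw [h4]
  rw [integral_smul_nnreal_measure]
  rfl

/-- The smallest `k`-Lipschitz majorant of a bounded function. -/
noncomputable def lipEnvelope {K : Type*} [PseudoMetricSpace K] (h : K → ℝ) (k : ℕ) (x : K) : ℝ :=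
  ⨆ y, h y - k * dist x y

section Envelope

variable {K : Type*} [PseudoMetricSpace K] {h : K → ℝ} {C : ℝ} (hC : ∀ x, |h x| ≤ C)

include hC

lemma bddAbove_lipEnvelope (k : ℕ) (x : K) : BddAbove (range fun y => h y - k * dist x y) := by
  refine ⟨C, ?_⟩
  rintro _ ⟨y, rfl⟩
  have := (abs_le.1 (hC y)).2
  have : 0 ≤ (k : ℝ) * dist x y := by positivity
  dsimp only
  linarith

lemma le_lipEnvelope (k : ℕ) (x : K) : h x ≤ lipEnvelope h k x := by
  simpa [lipEnvelope] using le_ciSup (bddAbove_lipEnvelope hC k x) x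

lemma lipEnvelope_le (k : ℕ) (x : K) : lipEnvelope h k x ≤ C := by
  have : Nonempty K := ⟨x⟩
  refine ciSup_le fun y => ?_
  have := (abs_le.1 (hC y)).2
  have : 0 ≤ (k : ℝ) * dist x y := by positivity
  linarith

lemma abs_lipEnvelope_le (k : ℕ) (x : K) : |lipEnvelope h k x| ≤ C :=
  abs_le.2 ⟨(abs_le.1 (hC x)).1.trans (le_lipEnvelope hC k x), lipEnvelope_le hC k x⟩

lemma continuous_lipEnvelope (k : ℕ) : Continuous (lipEnvelope h k) := by
  refine (LipschitzWith.of_le_add_mul (K := k) fun x x' => ?_).continuous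
  have : Nonempty K := ⟨x⟩
  refine ciSup_le fun y => ?_
  have h1 := le_ciSup (bddAbove_lipEnvelope hC k x') y
  have h2 : (k : ℝ) * dist x' y ≤ k * (dist x x' + dist x y) :=
    mul_le_mul_of_nonneg_left (by rw [dist_comm x x']; exact dist_triangle _ _ _) k.cast_nonneg
  change h y - k * dist x y ≤ lipEnvelope h k x' + ((k : NNReal) : ℝ) * dist x x'
  change h y - k * dist x' y ≤ lipEnvelope h k x' at h1
  push_cast
  linarith

lemma tendsto_lipEnvelope {x : K} (hx : ContinuousAt h x) :
    Tendsto (fun k => lipEnvelope h k x) atTop (𝓝 (h x)) := by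
  have : Nonempty K := ⟨x⟩
  refine tendsto_order.2 ⟨fun a ha => Eventually.of_forall fun k =>
    ha.trans_le (le_lipEnvelope hC k x), fun a ha => ?_⟩
  obtain ⟨b, hb, hba⟩ := exists_between ha
  obtain ⟨δ, hδ, hball⟩ := Metric.eventually_nhds_iff.1 (hx.eventually_lt_const hb)
  -- Within distance `δ` of `x` the function is below `b`; farther away the penalty `k δ > C - b`
  -- brings the bound `C` below `b`.
  obtain ⟨k₀, hk₀⟩ := exists_nat_gt ((C - b) / δ)
  filter_upwards [eventually_ge_atTop k₀] with k hk
  refine lt_of_le_of_lt (ciSup_le fun y => ?_) hba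
  by_cases hy : dist y x < δ
  · have := hball hy
    have : 0 ≤ (k : ℝ) * dist x y := by positivity
    linarith
  · have h1 : (C - b) / δ < k := hk₀.trans_le (by exact_mod_cast hk)
    rw [div_lt_iff₀ hδ] at h1
    have h2 : (k : ℝ) * δ ≤ k * dist x y :=
      mul_le_mul_of_nonneg_left (by rw [dist_comm]; exact not_lt.1 hy) k.cast_nonneg
    have := (abs_le.1 (hC y)).2
    linarith

end Envelope

variable {K : Type*} [TopologicalSpace K]
    [TopologicalSpace.MetrizableSpace K] [MeasurableSpace K] [BorelSpace K]
    {θ : ℕ → Measure K} [∀ n, IsFiniteMeasure (θ n)] {η : Measure K} [IsFiniteMeasure η]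

/-- The Lipschitz envelopes are continuous majorants that decrease to `h` where `h` is continuous,
so one of them already has `η`-integral below `a`, and weak convergence applies to it. The matching
lower bound comes from `-h`. -/
lemma eventually_integral_lt_of_ae_continuousAt
    (hθ : ∀ φ : C(K, ℝ), Tendsto (fun n => ∫ x, φ x ∂(θ n)) atTop (𝓝 (∫ x, φ x ∂η)))
    {h : K → ℝ} (hm : Measurable h) {C : ℝ} (hC : ∀ x, |h x| ≤ C)
    (hc : ∀ᵐ x ∂η, ContinuousAt h x) {a : ℝ} (ha : ∫ x, h x ∂η < a) :
    ∀ᶠ n in atTop, ∫ x, h x ∂(θ n) < a := by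
  let : MetricSpace K := TopologicalSpace.metrizableSpaceMetric K
  have h1 : Tendsto (fun k => ∫ x, lipEnvelope h k x ∂η) atTop (𝓝 (∫ x, h x ∂η)) := by
    refine tendsto_integral_of_dominated_convergence (fun _ => C)
      (fun k => (continuous_lipEnvelope hC k).aestronglyMeasurable) (integrable_const _)
      (fun k => Eventually.of_forall fun x => abs_lipEnvelope_le hC k x) ?_
    filter_upwards [hc] with x hx using tendsto_lipEnvelope hC hx
  obtain ⟨k, hk⟩ := (h1.eventually_lt_const ha).exists
  have h2 := hθ ⟨lipEnvelope h k, continuous_lipEnvelope hC k⟩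
  filter_upwards [h2.eventually_lt_const hk] with n hn
  refine lt_of_le_of_lt (integral_mono ?_ ?_ fun x => le_lipEnvelope hC k x) hn
  · exact Integrable.of_bound hm.aestronglyMeasurable C (Eventually.of_forall hC)
  · exact Integrable.of_bound (continuous_lipEnvelope hC k).aestronglyMeasurable C
      (Eventually.of_forall fun x => abs_lipEnvelope_le hC k x)

/-- Weak convergence of measures passes to bounded functions that are continuous almost everywhere
for the limit measure. -/
lemma tendsto_integral_of_ae_continuousAt
    (hθ : ∀ φ : C(K, ℝ), Tendsto (fun n => ∫ x, φ x ∂(θ n)) atTop (𝓝 (∫ x, φ x ∂η)))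
    {h : K → ℝ} (hm : Measurable h) {C : ℝ} (hC : ∀ x, |h x| ≤ C)
    (hc : ∀ᵐ x ∂η, ContinuousAt h x) :
    Tendsto (fun n => ∫ x, h x ∂(θ n)) atTop (𝓝 (∫ x, h x ∂η)) := by
  refine tendsto_order.2 ⟨fun a ha => ?_, fun a ha =>
    eventually_integral_lt_of_ae_continuousAt hθ hm hC hc ha⟩
  have := eventually_integral_lt_of_ae_continuousAt hθ hm.neg (C := C)
    (fun x => by simpa using hC x) (hc.mono fun x hx => hx.neg) (a := -a)
    (by simpa [integral_neg] using ha)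
  simpa [integral_neg] using this

end WeakConvergence

/-! ### Mass bounds for densities and singular parts. -/

section Density

variable {X : Type*} [MeasurableSpace X]
  {E : Type*} [NormedAddCommGroup E] [InnerProductSpace ℝ E] [FiniteDimensional ℝ E]

lemma lintegral_enorm_rnDeriv_le (s : SignedMeasure X) (m : Measure X) :
    ∫⁻ x, ‖s.rnDeriv m x‖ₑ ∂m ≤ s.variation univ := by
  rw [← SignedMeasure.totalVariation_eq_variation, SignedMeasure.totalVariation]
  refine (lintegral_mono (g := fun x => s.toJordanDecomposition.posPart.rnDeriv m x +
    s.toJordanDecomposition.negPart.rnDeriv m x) fun x => ?_).trans ?_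
  · simp only [SignedMeasure.rnDeriv_def]
    refine enorm_sub_le.trans (add_le_add ?_ ?_) <;>
      rw [Real.enorm_of_nonneg ENNReal.toReal_nonneg] <;> exact ENNReal.ofReal_toReal_le
  · rw [lintegral_add_left (Measure.measurable_rnDeriv _ _), Measure.add_apply]
    exact add_le_add Measure.lintegral_rnDeriv_le Measure.lintegral_rnDeriv_le

omit [FiniteDimensional ℝ E] in
lemma variation_component_le {e : E} (he : ‖e‖ ≤ 1) (μ : VectorMeasure X E) :
    (component e μ).variation ≤ μ.variation := by
  refine VectorMeasure.variation_le_of_forall_enorm_le fun s _ => ?_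
  refine le_trans ?_ (μ.enorm_measure_le_variation s)
  have : component e μ s = inner ℝ e (μ s) := rfl
  rw [this, enorm_le_iff_norm_le]
  exact (norm_inner_le_norm _ _).trans (mul_le_of_le_one_left (norm_nonneg _) he)

lemma stronglyMeasurable_density (μ : VectorMeasure X E) (m : Measure X) :
    StronglyMeasurable (density μ m) := by
  unfold density
  exact Finset.stronglyMeasurable_fun_sum _ fun i _ =>
    ((component _ μ).measurable_rnDeriv m).stronglyMeasurable.smul_const _

/-- Summing the components costs a factor `dim E`. The bound is crude, but only uniform boundedness
of the lifted masses matters. -/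
lemma lintegral_enorm_density_le (μ : VectorMeasure X E) (m : Measure X) :
    ∫⁻ x, ‖density μ m x‖ₑ ∂m ≤ Module.finrank ℝ E * μ.variation univ := by
  let b := stdOrthonormalBasis ℝ E
  calc ∫⁻ x, ‖density μ m x‖ₑ ∂m
      ≤ ∫⁻ x, ∑ i, ‖(component (b i) μ).rnDeriv m x‖ₑ ∂m := by
        refine lintegral_mono fun x => (enorm_sum_le _ _).trans (Finset.sum_le_sum fun i _ => ?_)
        rw [enorm_smul, ← ofReal_norm (stdOrthonormalBasis ℝ E i), OrthonormalBasis.norm_eq_one]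
        simp [b]
    _ = ∑ i, ∫⁻ x, ‖(component (b i) μ).rnDeriv m x‖ₑ ∂m :=
        lintegral_finsetSum _ fun i _ => ((component _ μ).measurable_rnDeriv m).enorm
    _ ≤ ∑ i : Fin (Module.finrank ℝ E), μ.variation univ :=
        Finset.sum_le_sum fun i _ => (lintegral_enorm_rnDeriv_le _ _).trans
          (variation_component_le (b.norm_eq_one i).le μ univ)
    _ = Module.finrank ℝ E * μ.variation univ := by simp

lemma integrable_density {μ : VectorMeasure X E} (hμ : μ.variation univ ≠ ∞) (m : Measure X) :
    Integrable (density μ m) m :=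
  ⟨(stronglyMeasurable_density μ m).aestronglyMeasurable,
    (lintegral_enorm_density_le μ m).trans_lt
      (ENNReal.mul_lt_top (ENNReal.natCast_lt_top _) hμ.lt_top)⟩

lemma singularVariation_univ_le {μ : VectorMeasure X E} (hμ : μ.variation univ ≠ ∞)
    (m : Measure X) :
    singularVariation μ m univ ≤ μ.variation univ + Module.finrank ℝ E * μ.variation univ := by
  refine (VectorMeasure.variation_sub_le univ).trans ?_
  rw [Measure.variation_withDensityᵥ (integrable_density hμ m), Measure.add_apply,
    withDensity_apply _ MeasurableSet.univ, Measure.restrict_univ]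
  gcongr
  exact lintegral_enorm_density_le μ m

end Density

/-! ### Equidistribution of the fast variable `x / ε`. -/

section Equidistribution

variable {d : ℕ}

instance : IsProbabilityMeasure (volume : Measure UnitAddCircle) :=
  ⟨by simp⟩

instance : IsProbabilityMeasure (volume : Measure (Torus d)) :=
  inferInstanceAs (IsProbabilityMeasure (Measure.pi fun _ => volume))

lemma measurable_fastVar (ε : ℝ) : Measurable (fastVar ε : EuclideanSpace ℝ (Fin d) → Torus d) := by
  refine measurable_pi_lambda _ fun i => ?_
  exact (AddCircle.continuous_mk' (1 : ℝ)).measurable.comp (by fun_prop)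

/-- Translation by half a period of the mode changes its sign. -/
lemma integral_fourier_unitAddCircle {n : ℤ} (hn : n ≠ 0) :
    ∫ x : UnitAddCircle, fourier n x = 0 :=
  integral_eq_zero_of_add_right_eq_neg fun x => fourier_add_half_inv_index hn (by simp) x

lemma integral_mFourier {k : Fin d → ℤ} (hk : k ≠ 0) :
    ∫ ξ : Torus d, UnitAddTorus.mFourier k ξ = 0 := by
  obtain ⟨i, hi⟩ := Function.ne_iff.1 hk
  have : ∫ ξ : Torus d, UnitAddTorus.mFourier k ξ = ∏ j, ∫ x : UnitAddCircle, fourier (k j) x :=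
    integral_fintype_prod_volume_eq_prod (fun j (x : UnitAddCircle) => fourier (k j) x)
  rw [this]
  exact Finset.prod_eq_zero (Finset.mem_univ i) (integral_fourier_unitAddCircle hi)

/-- The oscillating mode is a Fourier kernel at frequency `-k / ε`, which escapes to infinity as `ε
→ 0`; this is the form the Riemann-Lebesgue lemma needs. -/
lemma mFourier_fastVar (k : Fin d → ℤ) (ε : ℝ) (x : EuclideanSpace ℝ (Fin d)) :
    UnitAddTorus.mFourier k (fastVar ε x) =
      Real.fourierChar (-inner ℝ x (-ε⁻¹ • WithLp.toLp 2 fun i => (k i : ℝ))) := by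
  have h1 : UnitAddTorus.mFourier k (fastVar ε x) =
    ∏ i, fourier (k i) ((x i / ε : ℝ) : UnitAddCircle) := rfl
  rw [h1, Real.fourierChar_apply]
  simp_rw [fourier_coe_apply]
  rw [← Complex.exp_sum]
  congr 1
  simp only [PiLp.inner_apply, neg_smul, PiLp.smul_apply, inner_neg_right, neg_neg]
  push_cast
  rw [Finset.mul_sum, Finset.sum_mul]
  refine Finset.sum_congr rfl fun i _ => ?_
  simp
  ring

variable {ε : ℕ → ℝ} (hε_pos : ∀ n, 0 < ε n) (hε : Tendsto ε atTop (𝓝 0))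

include hε_pos hε

/-- The Riemann-Lebesgue lemma for oscillating Fourier modes. -/
lemma tendsto_integral_mul_mFourier (F : EuclideanSpace ℝ (Fin d) → ℂ) {k : Fin d → ℤ}
    (hk : k ≠ 0) :
    Tendsto (fun n => ∫ x, F x * UnitAddTorus.mFourier k (fastVar (ε n) x)) atTop (𝓝 0) := by
  let w : EuclideanSpace ℝ (Fin d) := WithLp.toLp 2 fun i => (k i : ℝ)
  have hw : w ≠ 0 := by
    obtain ⟨i, hi⟩ := Function.ne_iff.1 hk
    intro h
    have := congrArg (fun v : EuclideanSpace ℝ (Fin d) => v i) h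
    exact hi (by simpa [w] using this)
  have h1 : Tendsto (fun n => -(ε n)⁻¹ • w) atTop (cocompact (EuclideanSpace ℝ (Fin d))) := by
    rw [← Metric.cobounded_eq_cocompact, ← tendsto_norm_atTop_iff_cobounded]
    have h2 : Tendsto (fun n => (ε n)⁻¹) atTop atTop :=
      (tendsto_nhdsWithin_iff.2 ⟨hε, Eventually.of_forall hε_pos⟩).inv_tendsto_nhdsGT_zero
    refine (h2.atTop_mul_const (norm_pos_iff.2 hw)).congr fun n => ?_
    rw [norm_smul, norm_neg, norm_inv, Real.norm_of_nonneg (hε_pos n).le]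
  refine ((tendsto_integral_exp_inner_smul_cocompact F).comp h1).congr fun n => ?_
  refine integral_congr_ae (Eventually.of_forall fun x => ?_)
  simp only [mFourier_fastVar, Circle.smul_def, smul_eq_mul]
  rw [mul_comm]

/-- Rapidly oscillating periodic functions converge weakly to their mean. -/
lemma tendsto_integral_mul_fastVar {F : EuclideanSpace ℝ (Fin d) → ℂ} (hF : Integrable F)
    (g : C(Torus d, ℂ)) :
    Tendsto (fun n => ∫ x, F x * g (fastVar (ε n) x)) atTop
      (𝓝 ((∫ x, F x) * ∫ ξ, g ξ)) := by
  have hint (g : C(Torus d, ℂ)) (n : ℕ) : Integrable fun x => F x * g (fastVar (ε n) x) :=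
    hF.mul_bdd (c := ‖g‖) (g.continuous.measurable.comp (measurable_fastVar _)).aestronglyMeasurable
      (Eventually.of_forall fun x => g.norm_coe_le_norm _)
  have hgi (g : C(Torus d, ℂ)) : Integrable (fun ξ => g ξ) (volume : Measure (Torus d)) :=
    Integrable.of_bound g.continuous.aestronglyMeasurable ‖g‖
      (Eventually.of_forall g.norm_coe_le_norm)
  have hmem : g ∈ (Submodule.span ℂ
      (range (UnitAddTorus.mFourier (d := Fin d)))).topologicalClosure := by
    rw [UnitAddTorus.span_mFourier_closure_eq_top]; trivial
  have hspan : ∀ g ∈ Submodule.span ℂ (range (UnitAddTorus.mFourier (d := Fin d))),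
      Tendsto (fun n => ∫ x, F x * g (fastVar (ε n) x)) atTop (𝓝 ((∫ x, F x) * ∫ ξ, g ξ)) := by
    intro g hg
    induction hg using Submodule.span_induction with
    | mem g hg =>
      obtain ⟨k, rfl⟩ := hg
      by_cases hk : k = 0
      · subst hk
        simp [UnitAddTorus.mFourier_zero]
      · rw [integral_mFourier hk, mul_zero]
        exact tendsto_integral_mul_mFourier hε_pos hε F hk
    | zero => simp
    | add g g' _ _ h h' =>
      have := h.add h'
      rw [← mul_add, ← integral_add (hgi g) (hgi g')] at this
      refine this.congr fun n => ?_
      rw [← integral_add (hint g n) (hint g' n)]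
      simp [mul_add]
    | smul c g _ h =>
      have := h.const_mul c
      rw [mul_left_comm, ← integral_const_mul] at this
      refine this.congr fun n => ?_
      rw [← integral_const_mul]
      simp [mul_left_comm]
  rw [← SetLike.mem_coe, Submodule.topologicalClosure_coe] at hmem
  rw [Metric.tendsto_atTop]
  intro δ hδ
  set A := ∫ x, ‖F x‖
  have hA : 0 ≤ A := integral_nonneg fun x => norm_nonneg _
  -- Trigonometric polynomials are uniformly dense; `A + 1` replaces `A` because the `L¹` norm `A`
  -- may vanish.
  obtain ⟨g', hg', hgg'⟩ := Metric.mem_closure_iff.1 hmem (δ / (3 * (A + 1))) (by positivity)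
  obtain ⟨N, hN⟩ := Metric.tendsto_atTop.1 (hspan g' hg') (δ / 3) (by positivity)
  rw [dist_eq_norm] at hgg'
  have hA' : A * ‖g - g'‖ ≤ δ / 3 := by
    calc A * ‖g - g'‖ ≤ (A + 1) * (δ / (3 * (A + 1))) := by gcongr; linarith
      _ = δ / 3 := by field_simp
  refine ⟨N, fun n hn => ?_⟩
  have h1 : ‖(∫ x, F x * g (fastVar (ε n) x)) - ∫ x, F x * g' (fastVar (ε n) x)‖ ≤
      A * ‖g - g'‖ := by
    rw [← integral_sub (hint g n) (hint g' n), ← integral_mul_const]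
    refine norm_integral_le_of_norm_le (hF.norm.mul_const _) (Eventually.of_forall fun x => ?_)
    rw [← mul_sub, norm_mul]
    gcongr
    exact (g - g').norm_coe_le_norm _
  have h2 : ‖(∫ x, F x) * (∫ ξ, g' ξ) - (∫ x, F x) * ∫ ξ, g ξ‖ ≤ A * ‖g - g'‖ := by
    rw [← mul_sub, norm_mul, ← integral_sub (hgi g') (hgi g), norm_sub_rev]
    gcongr
    · exact norm_integral_le_integral_norm _
    · refine (norm_integral_le_of_norm_le_const (C := ‖g' - g‖)
        (Eventually.of_forall fun ξ => (g' - g).norm_coe_le_norm ξ)).trans ?_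
      simp
  have h3 := hN n hn
  rw [dist_eq_norm] at h3 ⊢
  calc _ = ‖((∫ x, F x * g (fastVar (ε n) x)) - ∫ x, F x * g' (fastVar (ε n) x)) +
        ((∫ x, F x * g' (fastVar (ε n) x)) - (∫ x, F x) * ∫ ξ, g' ξ) +
        ((∫ x, F x) * (∫ ξ, g' ξ) - (∫ x, F x) * ∫ ξ, g ξ)‖ := by congr 1; ring
    _ < δ := by
      refine (norm_add₃_le).trans_lt ?_
      linarith

/-- Rapidly oscillating periodic functions converge weakly to their mean, over the reals. -/
lemma tendsto_integral_mul_fastVar_real {F : EuclideanSpace ℝ (Fin d) → ℝ} (hF : Integrable F)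
    (g : C(Torus d, ℝ)) :
    Tendsto (fun n => ∫ x, F x * g (fastVar (ε n) x)) atTop
      (𝓝 ((∫ x, F x) * ∫ ξ, g ξ)) := by
  have h := tendsto_integral_mul_fastVar hε_pos hε (F := fun x => (F x : ℂ)) hF.ofReal
    ⟨fun ξ => (g ξ : ℂ), Complex.continuous_ofReal.comp g.continuous⟩
  have h' := (Complex.continuous_re.tendsto _).comp h
  simp only [ContinuousMap.coe_mk, Function.comp_def, ← Complex.ofReal_mul] at h'
  simpa only [integral_complex_ofReal, ← Complex.ofReal_mul, Complex.ofReal_re] using h'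

end Equidistribution

/-! ### Strong recession functions and the transform to the unit ball. -/

section StrongRecession

lemma comap_nhds_neBot_of_denseRange {P Q : Type*} [TopologicalSpace P] {ι : Q → P}
    (hι : DenseRange ι) (p : P) : (comap ι (𝓝 p)).NeBot := by
  refine comap_neBot fun t ht => ?_
  obtain ⟨_, hp, q, rfl⟩ := mem_closure_iff_nhds.1 (hι p) t ht
  exact ⟨q, hp⟩

/-- Limits along a filter that refines `𝓝 p` through a dense map depend continuously on `p`. -/
lemma continuous_of_tendsto_comap_prod {P Q R A : Type*} [TopologicalSpace P] [TopologicalSpace R]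
    [RegularSpace R] {l : Filter A} [l.NeBot] {ι : Q → P} (hι : DenseRange ι) {H : Q × A → R}
    {G : P → R} (h : ∀ p, Tendsto H (comap ι (𝓝 p) ×ˢ l) (𝓝 (G p))) : Continuous G := by
  refine continuous_iff_continuousAt.2 fun p => ?_
  -- A neighbourhood of `p` on which `H` stays in a closed `V` is also one of each nearby `p'`, and
  -- closedness puts the limit `G p'` in `V`.
  refine (closed_nhds_basis (G p)).tendsto_right_iff.2 fun V ⟨hV, hVc⟩ => ?_
  obtain ⟨pa, ha, pb, hb, hab⟩ := eventually_prod_iff.1 ((h p).eventually_mem hV)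
  obtain ⟨U, hU, hUa⟩ := mem_comap.1 ha
  filter_upwards [eventually_mem_nhds_iff.2 hU] with p' hp'
  have : (comap ι (𝓝 p')).NeBot := comap_nhds_neBot_of_denseRange hι p'
  refine hVc.mem_of_tendsto (h p') (eventually_prod_iff.2
    ⟨pa, mem_comap.2 ⟨U, hp', hUa⟩, pb, hb, fun hx _ hy => hab hx hy⟩)

variable {X T E : Type*} [TopologicalSpace X] [TopologicalSpace T] [NormedAddCommGroup E]
  [NormedSpace ℝ E]

/-- `G` is the strong recession function of `F` when both are defined on the same space. -/
def IsStrongRecession (F G : X × T × E → ℝ) : Prop :=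
  ∀ p, Tendsto (fun q : (X × T × E) × ℝ => F (q.1.1, q.1.2.1, q.2 • q.1.2.2) / q.2)
    (𝓝 p ×ˢ atTop) (𝓝 (G p))

variable {F G : X × T × E → ℝ}

/-- The limit is joint in the point and `t`, so the bound holds uniformly near each point;
compactness makes it global. -/
lemma IsStrongRecession.exists_forall_ge_of_isCompact (h : IsStrongRecession F G)
    {S : Set (X × T × E)} (hS : IsCompact S) :
    ∃ C t₀ : ℝ, ∀ p ∈ S, ∀ t ≥ t₀, |F (p.1, p.2.1, t • p.2.2)| ≤ C * t := by
  refine hS.induction_on (p := fun S => ∃ C t₀ : ℝ, ∀ p ∈ S, ∀ t ≥ t₀,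
    |F (p.1, p.2.1, t • p.2.2)| ≤ C * t) ⟨0, 0, by simp⟩ ?_ ?_ ?_
  · rintro S S' hSS' ⟨C, t₀, hC⟩
    exact ⟨C, t₀, fun p hp => hC p (hSS' hp)⟩
  · rintro S S' ⟨C, t₀, hC⟩ ⟨C', t₀', hC'⟩
    refine ⟨max C C', max 0 (max t₀ t₀'), fun p hp t ht => ?_⟩
    obtain ⟨ht0, ht1, ht2⟩ : 0 ≤ t ∧ t₀ ≤ t ∧ t₀' ≤ t := by simpa using ht
    rcases hp with hp | hp
    · exact (hC p hp t ht1).trans (mul_le_mul_of_nonneg_right (le_max_left _ _) ht0)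
    · exact (hC' p hp t ht2).trans (mul_le_mul_of_nonneg_right (le_max_right _ _) ht0)
  · intro p _
    obtain ⟨pa, ha, pb, hb, hab⟩ := eventually_prod_iff.1
      ((h p).eventually_mem (Metric.ball_mem_nhds _ one_pos))
    obtain ⟨t₀, ht₀⟩ := eventually_atTop.1 hb
    refine ⟨{q | pa q}, mem_nhdsWithin_of_mem_nhds ha, |G p| + 1, max t₀ 1, fun q hq t ht => ?_⟩
    obtain ⟨ht1, ht2⟩ : t₀ ≤ t ∧ 1 ≤ t := by simpa using ht
    have htp : 0 < t := by linarith
    have := hab hq (ht₀ t ht1)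
    rw [Metric.mem_ball, Real.dist_eq] at this
    rw [← div_le_iff₀ htp]
    nth_rw 2 [← abs_of_pos htp]
    rw [← abs_div]
    have h3 := abs_sub_abs_le_abs_sub (F (q.1, q.2.1, t • q.2.2) / t) (G p)
    linarith

/-- Write `z = t • (z / t)` with `t = |t₀| + 1 + |z|`: then `z / t` is in the unit ball and `t ≥
t₀`. Since the ball contains `0`, bounded `z` are covered too, and no continuity of `F` is needed.
-/
lemma IsStrongRecession.exists_abs_le [CompactSpace X] [CompactSpace T] [FiniteDimensional ℝ E]
    (h : IsStrongRecession F G) : ∃ C, 0 ≤ C ∧ ∀ x ξ z, |F (x, ξ, z)| ≤ C * (1 + ‖z‖) := by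
  have : ProperSpace E := FiniteDimensional.proper_real E
  obtain ⟨C, t₀, hC⟩ := h.exists_forall_ge_of_isCompact
    (isCompact_univ.prod (isCompact_univ.prod (isCompact_closedBall (0 : E) 1)))
  refine ⟨|C| * (|t₀| + 1), by positivity, fun x ξ z => ?_⟩
  have ht : 0 < |t₀| + 1 + ‖z‖ := by positivity
  have h1 := hC (x, ξ, (|t₀| + 1 + ‖z‖)⁻¹ • z) ⟨trivial, trivial, by
    rw [mem_closedBall_zero_iff, norm_smul, norm_inv, Real.norm_of_nonneg ht.le,
      inv_mul_le_iff₀ ht]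
    have := abs_nonneg t₀
    linarith⟩ (|t₀| + 1 + ‖z‖) (by have := le_abs_self t₀; have := norm_nonneg z; linarith)
  simp only [smul_smul, mul_inv_cancel₀ ht.ne', one_smul] at h1
  refine h1.trans ((mul_le_mul_of_nonneg_right (le_abs_self C) ht.le).trans ?_)
  rw [mul_assoc]
  refine mul_le_mul_of_nonneg_left ?_ (abs_nonneg C)
  nlinarith [mul_nonneg (abs_nonneg t₀) (norm_nonneg z)]

lemma IsStrongRecession.continuous (h : IsStrongRecession F G) : Continuous G :=
  continuous_of_tendsto_comap_prod (l := (atTop : Filter ℝ))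
    (H := fun q : (X × T × E) × ℝ => F (q.1.1, q.1.2.1, q.2 • q.1.2.2) / q.2)
    denseRange_id fun p => by rw [comap_id]; exact h p

lemma IsStrongRecession.abs_le {C : ℝ} (h : IsStrongRecession F G)
    (hC : ∀ x ξ z, |F (x, ξ, z)| ≤ C * (1 + ‖z‖)) (x : X) (ξ : T) (z : E) :
    |G (x, ξ, z)| ≤ C * ‖z‖ := by
  have h1 : Tendsto (fun t : ℝ => |F (x, ξ, t • z) / t|) atTop (𝓝 |G (x, ξ, z)|) :=
    ((h (x, ξ, z)).comp (tendsto_const_nhds.prodMk tendsto_id :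
      Tendsto (fun t : ℝ => ((x, ξ, z), t)) atTop (𝓝 (x, ξ, z) ×ˢ atTop))).abs
  have h2 : Tendsto (fun t : ℝ => C * (t⁻¹ + ‖z‖)) atTop (𝓝 (C * (0 + ‖z‖))) :=
    ((tendsto_inv_atTop_zero (𝕜 := ℝ)).add_const _).const_mul C
  rw [zero_add] at h2
  refine le_of_tendsto_of_tendsto h1 h2 ?_
  filter_upwards [eventually_gt_atTop 0] with t ht
  rw [abs_div, abs_of_pos ht, div_le_iff₀ ht]
  refine (hC _ _ _).trans (le_of_eq ?_)
  rw [norm_smul, Real.norm_of_nonneg ht.le]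
  field_simp

/-- The transform of `F`, defined on the compactification of `E` by the unit ball: it is
`(1 - |w|) F(x, ξ, w / (1 - |w|))` inside the ball and the recession function on the sphere. -/
noncomputable def ballTransform (F G : X × T × E → ℝ)
    (k : (X × T) × Metric.closedBall (0 : E) 1) : ℝ :=
  if ‖(k.2 : E)‖ < 1 then (1 - ‖(k.2 : E)‖) * F (k.1.1, k.1.2, (1 - ‖(k.2 : E)‖)⁻¹ • (k.2 : E))
  else G (k.1.1, k.1.2, k.2)

lemma abs_ballTransform_le {C : ℝ} (h : IsStrongRecession F G) (hC0 : 0 ≤ C)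
    (hC : ∀ x ξ z, |F (x, ξ, z)| ≤ C * (1 + ‖z‖)) (k : (X × T) × Metric.closedBall (0 : E) 1) :
    |ballTransform F G k| ≤ C := by
  unfold ballTransform
  split_ifs with hk
  · have h1 : 0 < 1 - ‖(k.2 : E)‖ := sub_pos.2 hk
    rw [abs_mul, abs_of_pos h1]
    refine (mul_le_mul_of_nonneg_left (hC _ _ _) h1.le).trans (le_of_eq ?_)
    rw [norm_smul, norm_inv, Real.norm_of_nonneg h1.le]
    field_simp
    ring
  · refine (h.abs_le hC _ _ _).trans (mul_le_of_le_one_right hC0 ?_)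
    exact mem_closedBall_zero_iff.1 k.2.2

omit [TopologicalSpace X] [TopologicalSpace T] in
lemma measurable_ballTransform [MeasurableSpace X] [MeasurableSpace T] [MeasurableSpace E]
    [BorelSpace E] (hF : Measurable F) (hG : Measurable G) : Measurable (ballTransform F G) := by
  have hw : Measurable fun k : (X × T) × Metric.closedBall (0 : E) 1 => (k.2 : E) :=
    measurable_subtype_coe.comp measurable_snd
  have hn : Measurable fun k : (X × T) × Metric.closedBall (0 : E) 1 => ‖(k.2 : E)‖ :=
    measurable_norm.comp hw
  refine Measurable.ite (measurableSet_lt hn measurable_const) ?_ ?_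
  · have hs : Measurable fun k : (X × T) × Metric.closedBall (0 : E) 1 =>
        (1 - ‖(k.2 : E)‖)⁻¹ • (k.2 : E) :=
      (measurable_const.sub hn).inv.smul hw
    fun_prop
  · fun_prop

lemma continuousAt_ballTransform_of_norm_lt {k : (X × T) × Metric.closedBall (0 : E) 1}
    (hk : ‖(k.2 : E)‖ < 1) (hF : ∀ z, ContinuousAt F (k.1.1, k.1.2, z)) :
    ContinuousAt (ballTransform F G) k := by
  have h1 : ContinuousAt (fun k : (X × T) × Metric.closedBall (0 : E) 1 =>
      (1 - ‖(k.2 : E)‖) * F (k.1.1, k.1.2, (1 - ‖(k.2 : E)‖)⁻¹ • (k.2 : E))) k := by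
    refine ContinuousAt.mul (by fun_prop) (ContinuousAt.comp (g := F) (hF _) ?_)
    have : 1 - ‖(k.2 : E)‖ ≠ 0 := (sub_pos.2 hk).ne'
    fun_prop (disch := assumption)
  refine h1.congr ?_
  have h2 : ContinuousAt (fun k : (X × T) × Metric.closedBall (0 : E) 1 => ‖(k.2 : E)‖) k := by
    fun_prop
  filter_upwards [h2.eventually_lt_const hk] with k' hk'
  simp only [ballTransform, if_pos hk']

/-- With `t = 1 / (1 - |w|)` the inner branch is `F(x, ξ, t w) / t`, and `t → ∞` at the sphere, so
this is exactly the recession limit. On the outer branch, continuity of `G` suffices. -/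
lemma IsStrongRecession.continuousAt_ballTransform_of_norm_eq (h : IsStrongRecession F G)
    {k : (X × T) × Metric.closedBall (0 : E) 1} (hk : ‖(k.2 : E)‖ = 1) :
    ContinuousAt (ballTransform F G) k := by
  have h0 : ballTransform F G k = G (k.1.1, k.1.2, k.2) := by
    simp [ballTransform, hk]
  rw [ContinuousAt, h0]
  have hp : Continuous fun k : (X × T) × Metric.closedBall (0 : E) 1 =>
      (k.1.1, k.1.2, (k.2 : E)) := by fun_prop
  refine Tendsto.if ?_ (((h.continuous.comp hp).tendsto k).mono_left inf_le_left)
  have h1 : Tendsto (fun k : (X × T) × Metric.closedBall (0 : E) 1 => (1 - ‖(k.2 : E)‖)⁻¹)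
      (𝓝 k ⊓ 𝓟 {k | ‖(k.2 : E)‖ < 1}) atTop := by
    refine Tendsto.inv_tendsto_nhdsGT_zero (tendsto_nhdsWithin_iff.2 ⟨?_, ?_⟩)
    · have : Continuous fun k : (X × T) × Metric.closedBall (0 : E) 1 => 1 - ‖(k.2 : E)‖ := by
        fun_prop
      have h2 := this.tendsto k
      simp only [hk, sub_self] at h2
      exact h2.mono_left inf_le_left
    · filter_upwards [mem_inf_of_right (mem_principal_self _)] with k' hk'
      exact sub_pos.2 hk'
  refine ((h (k.1.1, k.1.2, k.2)).comp
    (((hp.tendsto k).mono_left inf_le_left).prodMk h1)).congr fun k' => ?_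
  simp [mul_comm]

end StrongRecession

/-! ### Extension of integrands to the closure of `Ω`. -/

section Extension

variable {d : ℕ} {Ω : Set (EuclideanSpace ℝ (Fin d))}
  {E : Type*} [NormedAddCommGroup E] [InnerProductSpace ℝ E]
  {f : Ω × Torus d × E → ℝ} {finf : closure Ω × Torus d × E → ℝ}

/-- The inclusion of `Ω × 𝕋 × E` into `closure Ω × 𝕋 × E`. -/
def inclProd (Ω : Set (EuclideanSpace ℝ (Fin d))) (E : Type*) :
    Ω × Torus d × E → closure Ω × Torus d × E :=
  Prod.map (incl Ω) id

lemma isOpenEmbedding_incl (hΩ : IsOpen Ω) : IsOpenEmbedding (incl Ω) := by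
  refine ⟨IsEmbedding.inclusion subset_closure, ?_⟩
  rw [incl, Set.range_inclusion]
  exact hΩ.preimage continuous_subtype_val

lemma denseRange_incl : DenseRange (incl Ω) := by
  rw [incl, denseRange_inclusion_iff]

omit [InnerProductSpace ℝ E] in
lemma isOpenEmbedding_inclProd (hΩ : IsOpen Ω) : IsOpenEmbedding (inclProd Ω E) :=
  (isOpenEmbedding_incl hΩ).prodMap .id

omit [InnerProductSpace ℝ E] in
lemma denseRange_inclProd : DenseRange (inclProd Ω E) :=
  denseRange_incl.prodMap denseRange_id

omit [InnerProductSpace ℝ E] in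
-- Exhibits the filter in `IsRecession` as the trace of a neighbourhood filter under a dense map, as
-- `continuous_of_tendsto_comap_prod` requires.
lemma comap_inclProd_nhds (x : closure Ω) (ξ : Torus d) (z : E) :
    comap (fun y : Ω => (y : EuclideanSpace ℝ (Fin d))) (𝓝 (x : EuclideanSpace ℝ (Fin d)))
      ×ˢ 𝓝 ξ ×ˢ 𝓝 z = comap (inclProd Ω E) (𝓝 (x, ξ, z)) := by
  rw [nhds_prod_eq, nhds_prod_eq, nhds_subtype_eq_comap, inclProd]
  have := prod_comap_comap_eq (f₁ := comap ((↑) : closure Ω → _) (𝓝 (x : EuclideanSpace ℝ (Fin d))))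
    (f₂ := 𝓝 ξ ×ˢ 𝓝 z) (m₁ := incl Ω) (m₂ := id)
  rw [comap_id, comap_comap] at this
  exact this

lemma IsRecession.tendsto (h : IsRecession f finf) (p : closure Ω × Torus d × E) :
    Tendsto (fun q : (Ω × Torus d × E) × ℝ => f (q.1.1, q.1.2.1, q.2 • q.1.2.2) / q.2)
      (comap (inclProd Ω E) (𝓝 p) ×ˢ atTop) (𝓝 (finf p)) := by
  rw [← comap_inclProd_nhds]
  exact h p.1 p.2.1 p.2.2

lemma IsRecession.continuous (h : IsRecession f finf) : Continuous finf :=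
  continuous_of_tendsto_comap_prod denseRange_inclProd h.tendsto

/-- Substitute `t / s` for `t`: `f((t / s) s z) / (t / s) = s f(t z) / t`. -/
lemma IsRecession.smul (h : IsRecession f finf) {s : ℝ} (hs : 0 < s) (x : closure Ω)
    (ξ : Torus d) (z : E) : finf (x, ξ, s • z) = s * finf (x, ξ, z) := by
  have : (comap (inclProd Ω E) (𝓝 (x, ξ, z))).NeBot := 
    comap_nhds_neBot_of_denseRange denseRange_inclProd _
  have h1 : Tendsto (fun q : (Ω × Torus d × E) × ℝ => ((q.1.1, q.1.2.1, s • q.1.2.2), q.2 / s))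
      (comap (inclProd Ω E) (𝓝 (x, ξ, z)) ×ˢ atTop)
      (comap (inclProd Ω E) (𝓝 (x, ξ, s • z)) ×ˢ atTop) := by
    refine Tendsto.prodMk ?_ (tendsto_snd.atTop_div_const hs)
    rw [tendsto_comap_iff]
    have h2 : Tendsto (fun p : closure Ω × Torus d × E => (p.1, p.2.1, s • p.2.2))
        (𝓝 (x, ξ, z)) (𝓝 (x, ξ, s • z)) :=
      Continuous.tendsto' (by fun_prop) _ _ rfl
    exact h2.comp (tendsto_comap.comp tendsto_fst)
  refine tendsto_nhds_unique ((h.tendsto _).comp h1) (((h.tendsto (x, ξ, z)).const_mul s).congr ?_)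
  intro q
  simp only [Function.comp_apply, smul_smul]
  rw [div_mul_cancel₀ _ hs.ne']
  field_simp

lemma IsRecession.zero (h : IsRecession f finf) (x : closure Ω) (ξ : Torus d) :
    finf (x, ξ, (0 : E)) = 0 := by
  have := h.smul two_pos x ξ 0
  rw [smul_zero] at this
  linarith

/-- The extension of an integrand to the closure of `Ω` by its recession function. -/
noncomputable def extendIntegrand (f : Ω × Torus d × E → ℝ) (finf : closure Ω × Torus d × E → ℝ) :
    closure Ω × Torus d × E → ℝ :=
  Function.extend (inclProd Ω E) f finf

omit [InnerProductSpace ℝ E] in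
lemma extendIntegrand_incl (hΩ : IsOpen Ω) (x : Ω) (ξ : Torus d) (z : E) :
    extendIntegrand f finf (incl Ω x, ξ, z) = f (x, ξ, z) :=
  (isOpenEmbedding_inclProd hΩ).injective.extend_apply f finf (x, ξ, z)

omit [NormedAddCommGroup E] [InnerProductSpace ℝ E] in
lemma extendIntegrand_of_notMem {x : closure Ω} (hx : x ∉ range (incl Ω)) (ξ : Torus d) (z : E) :
    extendIntegrand f finf (x, ξ, z) = finf (x, ξ, z) :=
  Function.extend_apply' _ _ _ fun ⟨p, hp⟩ => hx ⟨p.1, congrArg Prod.fst hp⟩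

omit [InnerProductSpace ℝ E] in
lemma continuousAt_extendIntegrand (hΩ : IsOpen Ω) (hf : Continuous f) (x : Ω) (ξ : Torus d)
    (z : E) : ContinuousAt (extendIntegrand f finf) (incl Ω x, ξ, z) := by
  have h := isOpenEmbedding_inclProd (E := E) hΩ
  have : (incl Ω x, ξ, z) = inclProd Ω E (x, ξ, z) := rfl
  rw [this, ← h.continuousAt_iff]
  exact hf.continuousAt.congr (Eventually.of_forall fun p => (h.injective.extend_apply _ _ p).symm)

omit [InnerProductSpace ℝ E] in
lemma measurable_extendIntegrand [MeasurableSpace E] [BorelSpace E] [SecondCountableTopology E]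
    (hΩ : IsOpen Ω) (hf : Continuous f) (hfinf : Continuous finf) :
    Measurable (extendIntegrand f finf) :=
  (isOpenEmbedding_inclProd hΩ).measurableEmbedding.measurable_extend hf.measurable
    hfinf.measurable

/-- Over `Ω` the quotient is the given one; over the boundary, 1-homogeneity makes it equal to
`finf`, which is continuous. -/
lemma IsRecession.isStrongRecession (hΩ : IsOpen Ω) (h : IsRecession f finf) :
    IsStrongRecession (extendIntegrand f finf) finf := by
  intro p V hV
  obtain ⟨pa, ha, pb, hb, hab⟩ := eventually_prod_iff.1 ((h.tendsto p).eventually_mem hV)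
  obtain ⟨U, hU, hUa⟩ := mem_comap.1 ha
  refine eventually_prod_iff.2 ⟨_, inter_mem hU (h.continuous.tendsto p hV), _,
    hb.and (eventually_gt_atTop 0), ?_⟩
  rintro ⟨x, ξ, z⟩ ⟨hxU, hxV⟩ t ⟨ht, ht0⟩
  by_cases hx : x ∈ range (incl Ω)
  · obtain ⟨y, rfl⟩ := hx
    simp only [extendIntegrand_incl hΩ]
    exact hab (x := (y, ξ, z)) (hUa hxU) ht
  · simp only [extendIntegrand_of_notMem hx]
    rw [h.smul ht0, mul_div_cancel_left₀ _ ht0.ne']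
    exact hxV

end Extension

/-! ### Splitting a measure on the compactification into finite and infinite parts. -/

section Splitting

variable {X T E : Type*} [MeasurableSpace X] [MeasurableSpace T]
  [NormedAddCommGroup E] [NormedSpace ℝ E] [MeasurableSpace E]

/-- The part of a measure on the compactified space that lives at finite distance. -/
noncomputable def oscMeasure (θ : Measure ((X × T) × Metric.closedBall (0 : E) 1)) :
    Measure ((X × T) × E) :=
  (θ.withDensity fun k => ENNReal.ofReal (1 - ‖(k.2 : E)‖)).map
    fun k => (k.1, (1 - ‖(k.2 : E)‖)⁻¹ • (k.2 : E))

/-- The part of a measure on the compactified space that lives at infinity. -/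
noncomputable def angMeasure (θ : Measure ((X × T) × Metric.closedBall (0 : E) 1)) :
    Measure ((X × T) × Metric.sphere (0 : E) 1) :=
  θ.comap (Prod.map id (Set.inclusion Metric.sphere_subset_closedBall))

variable (θ : Measure ((X × T) × Metric.closedBall (0 : E) 1)) [IsFiniteMeasure θ]

instance isFiniteMeasure_withDensity_one_sub_norm :
    IsFiniteMeasure (θ.withDensity fun k => ENNReal.ofReal (1 - ‖(k.2 : E)‖)) := by
  refine isFiniteMeasure_withDensity (ne_top_of_le_ne_top (measure_ne_top θ univ) ?_)
  rw [← lintegral_one]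
  exact lintegral_mono fun k => ENNReal.ofReal_le_one.2 (by linarith [norm_nonneg (k.2 : E)])

instance : IsFiniteMeasure (oscMeasure θ) := by
  unfold oscMeasure; infer_instance

variable [BorelSpace E]

omit [IsFiniteMeasure θ] [NormedSpace ℝ E] in
lemma measurable_one_sub_norm :
    Measurable fun k : (X × T) × Metric.closedBall (0 : E) 1 => 1 - ‖(k.2 : E)‖ :=
  measurable_const.sub (measurable_norm.comp (measurable_subtype_coe.comp measurable_snd))

lemma measurable_dilate :
    Measurable fun k : (X × T) × Metric.closedBall (0 : E) 1 =>
      (k.1, (1 - ‖(k.2 : E)‖)⁻¹ • (k.2 : E)) :=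
  measurable_fst.prodMk
    (measurable_one_sub_norm.inv.smul (measurable_subtype_coe.comp measurable_snd))

omit [NormedSpace ℝ E] in
lemma measurableEmbedding_sphere_inclusion :
    MeasurableEmbedding (Prod.map (id : X × T → X × T)
      (Set.inclusion (Metric.sphere_subset_closedBall (x := (0 : E)) (ε := 1)))) := by
  refine MeasurableEmbedding.id.prodMap (IsClosedEmbedding.measurableEmbedding ?_)
  refine ⟨IsEmbedding.inclusion _, ?_⟩
  rw [Set.range_inclusion]
  exact Metric.isClosed_sphere.preimage continuous_subtype_val

instance : IsFiniteMeasure (angMeasure θ) :=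
  ⟨by
    rw [angMeasure, measurableEmbedding_sphere_inclusion.comap_apply]
    exact measure_lt_top _ _⟩

omit [NormedSpace ℝ E] [BorelSpace E] [MeasurableSpace E] [MeasurableSpace T] [MeasurableSpace X] in
lemma range_sphere_inclusion :
    range (Prod.map (id : X × T → X × T)
      (Set.inclusion (Metric.sphere_subset_closedBall (x := (0 : E)) (ε := 1)))) =
      {k | ‖(k.2 : E)‖ < 1}ᶜ := by
  ext ⟨p, w⟩
  have hw := mem_closedBall_zero_iff.1 w.2
  simp only [range_prodMap, range_id, Set.range_inclusion]
  simp [le_antisymm_iff, hw]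

variable {F G : X × T × E → ℝ} {C : ℝ}

/-- The weight turns linear growth into a bound: `(1 - |w|) (1 + |w| / (1 - |w|)) = 1`. -/
lemma integrable_oscMeasure (hF : Measurable F) (hC : ∀ x ξ z, |F (x, ξ, z)| ≤ C * (1 + ‖z‖)) :
    Integrable (fun q : (X × T) × E => F (q.1.1, q.1.2, q.2)) (oscMeasure θ) := by
  have hF' : Measurable fun q : (X × T) × E => F (q.1.1, q.1.2, q.2) := by fun_prop
  rw [oscMeasure, integrable_map_measure hF'.aestronglyMeasurable measurable_dilate.aemeasurable,
    integrable_withDensity_iff_integrable_smul' measurable_one_sub_norm.ennreal_ofReal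
      (Eventually.of_forall fun _ => ENNReal.ofReal_lt_top)]
  refine Integrable.of_bound ?_ |C| (Eventually.of_forall fun k => ?_)
  · exact (measurable_one_sub_norm.ennreal_ofReal.ennreal_toReal.smul
      (hF'.comp measurable_dilate)).aestronglyMeasurable
  · have hk : 0 ≤ 1 - ‖(k.2 : E)‖ := sub_nonneg.2 (mem_closedBall_zero_iff.1 k.2.2)
    rw [ENNReal.toReal_ofReal hk, Function.comp_apply, norm_smul, Real.norm_of_nonneg hk]
    rcases hk.eq_or_lt with h0 | h0
    · simp [← h0]
    refine (mul_le_mul_of_nonneg_left (hC _ _ _) hk).trans (le_trans (le_of_eq ?_) (le_abs_self C))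
    rw [norm_smul, norm_inv, Real.norm_of_nonneg hk]
    field_simp
    ring

omit [NormedSpace ℝ E] in
lemma integrable_angMeasure (hG : Measurable G) (hC : ∀ x ξ z, |G (x, ξ, z)| ≤ C * ‖z‖) :
    Integrable (fun q : (X × T) × Metric.sphere (0 : E) 1 => G (q.1.1, q.1.2, (q.2 : E)))
      (angMeasure θ) := by
  refine Integrable.of_bound (Measurable.aestronglyMeasurable (by fun_prop)) C
    (Eventually.of_forall fun q => ?_)
  simpa using hC q.1.1 q.1.2 (q.2 : E)

omit [IsFiniteMeasure θ] in
/-- The integral of the transform splits into a part at finite distance and a part at infinity. -/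
lemma setIntegral_ballTransform (hF : Measurable F)
    {S : Set (X × T)} (hS : MeasurableSet S) (hi : Integrable (ballTransform F G) θ) :
    ∫ k in S ×ˢ univ, ballTransform F G k ∂θ =
      ∫ q in S ×ˢ univ, F (q.1.1, q.1.2, q.2) ∂(oscMeasure θ) +
      ∫ q in S ×ˢ univ, G (q.1.1, q.1.2, (q.2 : E)) ∂(angMeasure θ) := by
  have hF' : Measurable fun q : (X × T) × E => F (q.1.1, q.1.2, q.2) := by fun_prop
  let A : Set ((X × T) × Metric.closedBall (0 : E) 1) := {k | ‖(k.2 : E)‖ < 1}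
  have hA : MeasurableSet A := measurableSet_lt
    (measurable_norm.comp (measurable_subtype_coe.comp measurable_snd)) measurable_const
  have hSu : MeasurableSet (S ×ˢ (univ : Set (Metric.closedBall (0 : E) 1))) :=
    hS.prod MeasurableSet.univ
  rw [← integral_inter_add_sdiff hA hi.integrableOn]
  congr 1
  · rw [oscMeasure, setIntegral_map (hS.prod MeasurableSet.univ) hF'.aestronglyMeasurable
      measurable_dilate.aemeasurable,
      setIntegral_withDensity_eq_setIntegral_toReal_smul measurable_one_sub_norm.ennreal_ofReal
        (Eventually.of_forall fun _ => ENNReal.ofReal_lt_top) _ (measurable_dilate (hS.prod .univ))]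
    have : (fun k : (X × T) × Metric.closedBall (0 : E) 1 =>
        (k.1, (1 - ‖(k.2 : E)‖)⁻¹ • (k.2 : E))) ⁻¹' (S ×ˢ univ) = S ×ˢ univ := by
      ext; simp
    rw [this]
    refine Eq.trans ?_ (setIntegral_eq_of_subset_of_forall_sdiff_eq_zero hSu
      (inter_subset_left : (S ×ˢ univ) ∩ A ⊆ _) ?_).symm
    · refine setIntegral_congr_fun (hSu.inter hA) fun k hk => ?_
      have hk' : ‖(k.2 : E)‖ < 1 := hk.2
      simp only [ballTransform, if_pos hk', smul_eq_mul]
      rw [ENNReal.toReal_ofReal (sub_nonneg.2 hk'.le)]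
    -- On the sphere the weight `1 - |w|` vanishes, so the default value of the dilation there is
    -- harmless.
    · rintro k ⟨hk, hkA⟩
      have hk' : ¬ ‖(k.2 : E)‖ < 1 := fun h => hkA ⟨hk, h⟩
      rw [ENNReal.ofReal_of_nonpos (by linarith)]
      simp
  · have hj := measurableEmbedding_sphere_inclusion (X := X) (T := T) (E := E)
    have h1 : θ.restrict (S ×ˢ univ \ A) = ((angMeasure θ).map (Prod.map id
        (Set.inclusion Metric.sphere_subset_closedBall))).restrict (S ×ˢ univ) := by
      rw [angMeasure, hj.map_comap, range_sphere_inclusion, Measure.restrict_restrict hSu]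
      rfl
    have h2 : ∫ k in S ×ˢ univ \ A, ballTransform F G k ∂θ =
        ∫ k in S ×ˢ univ \ A, G (k.1.1, k.1.2, (k.2 : E)) ∂θ := by
      refine setIntegral_congr_fun (hSu.diff hA) fun k hk => ?_
      have hk' : ¬ ‖(k.2 : E)‖ < 1 := hk.2
      simp only [ballTransform, if_neg hk']
    rw [h2, h1, hj.setIntegral_map]
    have : Prod.map (id : X × T → X × T) (Set.inclusion (Metric.sphere_subset_closedBall
        (x := (0 : E)) (ε := 1))) ⁻¹' (S ×ˢ univ) = S ×ˢ univ := by
      ext; simp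
    rw [this]
    rfl

lemma lintegral_enorm_oscMeasure_lt_top : ∫⁻ q, ‖q.2‖ₑ ∂(oscMeasure θ) < ∞ := by
  rw [oscMeasure, lintegral_map (by fun_prop) measurable_dilate,
    lintegral_withDensity_eq_lintegral_mul _ measurable_one_sub_norm.ennreal_ofReal
      (measurable_dilate.snd.enorm)]
  refine lt_of_le_of_lt (lintegral_mono (g := fun _ => 1) fun k => ?_) (by simp)
  have hk : 0 ≤ 1 - ‖(k.2 : E)‖ := sub_nonneg.2 (mem_closedBall_zero_iff.1 k.2.2)
  rw [Pi.mul_apply, enorm_smul, ← ofReal_norm (k.2 : E), ← ofReal_norm (1 - ‖(k.2 : E)‖)⁻¹,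
    ← ENNReal.ofReal_mul (norm_nonneg _), ← ENNReal.ofReal_mul hk, norm_inv, Real.norm_of_nonneg hk,
    ENNReal.ofReal_le_one]
  rcases hk.eq_or_lt with h0 | h0
  · simp [← h0]
  · rw [mul_inv_cancel_left₀ h0.ne']
    linarith

omit [IsFiniteMeasure θ] in
lemma integral_fst_oscMeasure (g : X × T → ℝ) (hg : Measurable g) :
    ∫ p, g p ∂(oscMeasure θ).fst = ∫ k, (1 - ‖(k.2 : E)‖) * g k.1 ∂θ := by
  rw [Measure.fst, integral_map measurable_fst.aemeasurable hg.aestronglyMeasurable, oscMeasure,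
    integral_map (f := fun q : (X × T) × E => g q.1) measurable_dilate.aemeasurable
      (hg.comp measurable_fst).aestronglyMeasurable,
    integral_withDensity_eq_integral_toReal_smul measurable_one_sub_norm.ennreal_ofReal
      (Eventually.of_forall fun _ => ENNReal.ofReal_lt_top)]
  refine integral_congr_ae (Eventually.of_forall fun k => ?_)
  have hk : 0 ≤ 1 - ‖(k.2 : E)‖ := sub_nonneg.2 (mem_closedBall_zero_iff.1 k.2.2)
  simp [ENNReal.toReal_ofReal hk]

end Splitting

/-! ### Lebesgue measure on the closure and standard Borel instances. -/

section Disintegration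

variable {d : ℕ} {Ω : Set (EuclideanSpace ℝ (Fin d))}
  {E : Type*} [NormedAddCommGroup E] [InnerProductSpace ℝ E]
  [FiniteDimensional ℝ E] [Nontrivial E] [MeasurableSpace E] [BorelSpace E]

lemma measurableEmbedding_incl (hΩ : IsOpen Ω) : MeasurableEmbedding (incl Ω) :=
  (isOpenEmbedding_incl hΩ).measurableEmbedding

lemma map_incl_leb (hΩ : IsOpen Ω) (hbdry : volume (frontier Ω) = 0) :
    (leb Ω).map (incl Ω) = leb (closure Ω) := by
  ext s hs
  rw [(measurableEmbedding_incl hΩ).map_apply, leb, leb,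
    (MeasurableEmbedding.subtype_coe hΩ.measurableSet).comap_apply,
    (MeasurableEmbedding.subtype_coe isClosed_closure.measurableSet).comap_apply]
  have h1 : (Subtype.val '' (incl Ω ⁻¹' s) : Set (EuclideanSpace ℝ (Fin d))) =
      Subtype.val '' s ∩ Ω := by
    ext x
    constructor
    · rintro ⟨y, hy, rfl⟩
      exact ⟨⟨incl Ω y, hy, rfl⟩, y.2⟩
    · rintro ⟨⟨y, hy, rfl⟩, hx⟩
      exact ⟨⟨y, hx⟩, hy, rfl⟩
  rw [h1]
  refine le_antisymm (measure_mono inter_subset_left) ?_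
  calc volume (Subtype.val '' s) ≤ volume ((Subtype.val '' s ∩ Ω) ∪ frontier Ω) := by
        refine measure_mono fun x hx => ?_
        by_cases hxΩ : x ∈ Ω
        · exact Or.inl ⟨hx, hxΩ⟩
        · obtain ⟨y, -, rfl⟩ := hx
          exact Or.inr ⟨y.2, by rwa [hΩ.interior_eq]⟩
    _ ≤ volume (Subtype.val '' s ∩ Ω) + volume (frontier Ω) := measure_union_le _ _
    _ = volume (Subtype.val '' s ∩ Ω) := by rw [hbdry, add_zero]

lemma isFiniteMeasure_leb {S : Set (EuclideanSpace ℝ (Fin d))} (hS : MeasurableSet S)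
    (hb : Bornology.IsBounded S) : IsFiniteMeasure (leb S) :=
  ⟨by
    rw [leb, (MeasurableEmbedding.subtype_coe hS).comap_apply, image_univ, Subtype.range_coe]
    exact hb.measure_lt_top⟩

instance : StandardBorelSpace (Metric.sphere (0 : E) 1) :=
  have : ProperSpace E := FiniteDimensional.proper_real E
  Metric.isClosed_sphere.measurableSet.standardBorel

instance : Nonempty (Metric.sphere (0 : E) 1) :=
  (NormedSpace.sphere_nonempty.2 zero_le_one).to_subtype

instance : StandardBorelSpace E :=
  have : ProperSpace E := FiniteDimensional.proper_real E
  inferInstance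

end Disintegration

lemma map_compProd_comap {A A' B : Type*} [MeasurableSpace A] [MeasurableSpace A']
    [MeasurableSpace B] (P : Measure A) [SFinite P] (κ : Kernel A' B) [IsSFiniteKernel κ]
    {g : A → A'} (hg : Measurable g) :
    (P ⊗ₘ κ.comap g hg).map (Prod.map g id) = (P.map g) ⊗ₘ κ := by
  ext s hs
  rw [Measure.map_apply (hg.prodMap measurable_id) hs, Measure.compProd_apply hs,
    Measure.compProd_apply ((hg.prodMap measurable_id) hs),
    lintegral_map (Kernel.measurable_kernel_prodMk_left hs) hg]
  rfl

lemma measurableEmbedding_incl_prod {d : ℕ} {Ω : Set (EuclideanSpace ℝ (Fin d))} (hΩ : IsOpen Ω)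
    (E : Type*) [MeasurableSpace E] :
    MeasurableEmbedding (Prod.map (Prod.map (incl Ω) id) id :
      (Ω × Torus d) × E → (closure Ω × Torus d) × E) :=
  ((measurableEmbedding_incl hΩ).prodMap .id).prodMap .id

/-! ### Disintegration into a Young measure and the representation formula. -/

section YoungMeasureOf

variable {d : ℕ} {Ω : Set (EuclideanSpace ℝ (Fin d))}
  {E : Type*} [NormedAddCommGroup E] [InnerProductSpace ℝ E]
  [FiniteDimensional ℝ E] [Nontrivial E] [MeasurableSpace E] [BorelSpace E]

/-- The two-scale Young measure obtained by disintegrating a measure on the compactified space. -/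
noncomputable def youngMeasureOf
    (θ : Measure ((closure Ω × Torus d) × Metric.closedBall (0 : E) 1)) [IsFiniteMeasure θ]
    (hθ : (oscMeasure θ).fst = (leb (closure Ω)).prod volume) : YoungMeasure Ω E where
  osc := (oscMeasure θ).condKernel
  osc_prob := inferInstance
  osc_moment := by
    rw [← hθ, ← Measure.lintegral_compProd (f := fun q => ‖q.2‖ₑ) (by fun_prop),
      Measure.disintegrate]
    exact lintegral_enorm_oscMeasure_lt_top θ
  conc := (angMeasure θ).fst.fst
  conc_finite := inferInstance
  rho := (angMeasure θ).fst.condKernel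
  rho_prob := inferInstance
  ang := (angMeasure θ).condKernel
  ang_prob := inferInstance

variable (hΩ : IsOpen Ω) (hb : Bornology.IsBounded Ω) (hbdry : volume (frontier Ω) = 0)
  {θ : Measure ((closure Ω × Torus d) × Metric.closedBall (0 : E) 1)} [IsFiniteMeasure θ]
  (hθ : (oscMeasure θ).fst = (leb (closure Ω)).prod volume)

lemma ang_youngMeasureOf :
    ((youngMeasureOf θ hθ).conc ⊗ₘ (youngMeasureOf θ hθ).rho) ⊗ₘ (youngMeasureOf θ hθ).ang =
      angMeasure θ := by
  simp only [youngMeasureOf, Measure.disintegrate]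

include hΩ hb hbdry

/-- Since the boundary is Lebesgue-null, restricting `ν` to `Ω` loses no mass. -/
lemma map_oscInterior_youngMeasureOf :
    (((leb Ω).prod (volume : Measure (Torus d))) ⊗ₘ (youngMeasureOf θ hθ).oscInterior).map
      (Prod.map (Prod.map (incl Ω) id) id) = oscMeasure θ := by
  have := isFiniteMeasure_leb hΩ.measurableSet hb
  have hincl := (measurableEmbedding_incl hΩ).measurable
  have h1 := map_compProd_comap ((leb Ω).prod (volume : Measure (Torus d)))
    (oscMeasure θ).condKernel (hincl.prodMap measurable_id)
  rw [← Measure.map_prod_map _ _ hincl measurable_id, map_incl_leb hΩ hbdry, Measure.map_id, ← hθ,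
    Measure.disintegrate] at h1
  exact h1

variable {f : Ω × Torus d × E → ℝ} {finf : closure Ω × Torus d × E → ℝ}
  (hf : Continuous f) (hr : IsRecession f finf)

include hf hr

lemma pairingIntegrable_youngMeasureOf : PairingIntegrable (youngMeasureOf θ hθ) f finf := by
  have hcpt : CompactSpace (closure Ω) := isCompact_iff_compactSpace.1 hb.isCompact_closure
  have hF := measurable_extendIntegrand hΩ hf hr.continuous
  have hs := hr.isStrongRecession hΩ
  obtain ⟨C, hC0, hC⟩ := hs.exists_abs_le
  refine ⟨?_, ?_⟩
  · have h := integrable_oscMeasure θ hF hC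
    rw [← map_oscInterior_youngMeasureOf hΩ hb hbdry hθ,
      (measurableEmbedding_incl_prod hΩ E).integrable_map_iff] at h
    refine h.congr (Eventually.of_forall fun q => ?_)
    exact extendIntegrand_incl hΩ _ _ _
  · rw [ang_youngMeasureOf]
    exact integrable_angMeasure θ hr.continuous.measurable (hs.abs_le hC)

/-- Split at the sphere, then apply Fubini to the disintegration of each part. -/
lemma setIntegral_ballTransform_eq {ω : Set (closure Ω)} (hω : MeasurableSet ω) :
    ∫ k in (ω ×ˢ univ) ×ˢ univ, ballTransform (extendIntegrand f finf) finf k ∂θ =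
      oscPart (youngMeasureOf θ hθ) f ω + concPart (youngMeasureOf θ hθ) finf ω := by
  have hcpt : CompactSpace (closure Ω) := isCompact_iff_compactSpace.1 hb.isCompact_closure
  have hfin := isFiniteMeasure_leb hΩ.measurableSet hb
  have hF := measurable_extendIntegrand hΩ hf hr.continuous
  have hs := hr.isStrongRecession hΩ
  obtain ⟨C, hC0, hC⟩ := hs.exists_abs_le
  obtain ⟨hI, hI'⟩ := pairingIntegrable_youngMeasureOf hΩ hb hbdry hθ hf hr
  have : IsMarkovKernel (youngMeasureOf θ hθ).oscInterior := by
    have := (youngMeasureOf θ hθ).osc_prob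
    exact Kernel.IsMarkovKernel.comap _ _
  have := (youngMeasureOf θ hθ).ang_prob
  have := (youngMeasureOf θ hθ).rho_prob
  have := (youngMeasureOf θ hθ).conc_finite
  have hincl := (measurableEmbedding_incl hΩ).measurable
  rw [setIntegral_ballTransform θ hF (hω.prod .univ)
    (Integrable.of_bound (measurable_ballTransform hF hr.continuous.measurable).aestronglyMeasurable
      C (Eventually.of_forall (abs_ballTransform_le hs hC0 hC)))]
  congr 1
  · rw [← map_oscInterior_youngMeasureOf hΩ hb hbdry hθ,
      (measurableEmbedding_incl_prod hΩ E).setIntegral_map]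
    have h1 : (Prod.map (Prod.map (incl Ω) id) id : (Ω × Torus d) × E → _) ⁻¹'
        ((ω ×ˢ univ) ×ˢ univ) = ((incl Ω ⁻¹' ω) ×ˢ univ) ×ˢ univ := by
      ext; simp
    rw [h1]
    simp only [Prod.map_fst, Prod.map_snd, id_eq, extendIntegrand_incl hΩ]
    rw [Measure.setIntegral_compProd ((hincl hω).prod .univ) .univ hI.integrableOn, setIntegral_prod]
    · simp only [Measure.restrict_univ]
      rfl
    · simp only [Measure.restrict_univ]
      exact (Integrable.integral_compProd hI).integrableOn
  · rw [← ang_youngMeasureOf hθ, Measure.setIntegral_compProd (hω.prod .univ) .univ hI'.integrableOn,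
      Measure.setIntegral_compProd hω .univ]
    · simp only [Measure.restrict_univ]
      rfl
    · simp only [Measure.restrict_univ]
      exact (Integrable.integral_compProd hI').integrableOn

end YoungMeasureOf

/-! ### Lifting a measure to the compactified space. -/

section Lift

variable {d : ℕ} {Ω : Set (EuclideanSpace ℝ (Fin d))} {E : Type*} [NormedAddCommGroup E]
  [NormedSpace ℝ E]

/-- The homeomorphism `z ↦ z / (1 + |z|)` of `E` onto the open unit ball. -/
noncomputable def toBall (z : E) : Metric.closedBall (0 : E) 1 :=
  ⟨(1 + ‖z‖)⁻¹ • z, by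
    have := norm_nonneg z
    rw [mem_closedBall_zero_iff, norm_smul, norm_inv, Real.norm_of_nonneg (by positivity),
      inv_mul_le_iff₀ (by positivity)]
    linarith⟩

/-- The direction `z / |z|` of a vector. -/
noncomputable def direction (z : E) : Metric.closedBall (0 : E) 1 :=
  ⟨‖z‖⁻¹ • z, by
    rw [mem_closedBall_zero_iff, norm_smul, norm_inv, norm_norm]
    exact inv_mul_le_one⟩

lemma one_sub_norm_toBall (z : E) : 1 - ‖(toBall z : E)‖ = (1 + ‖z‖)⁻¹ := by
  have : 0 < 1 + ‖z‖ := by positivity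
  rw [toBall, norm_smul, norm_inv, Real.norm_of_nonneg this.le]
  field_simp
  ring

lemma norm_direction {z : E} (hz : z ≠ 0) : ‖(direction z : E)‖ = 1 := by
  rw [direction, norm_smul, norm_inv, norm_norm, inv_mul_cancel₀ (norm_ne_zero_iff.2 hz)]

/-- The mass factor `1 + |z|` of the lift is the inverse of the factor `1 - |w|` of the transform.
-/
lemma ballTransform_toBall {X T : Type*} (F G : X × T × E → ℝ) (x : X) (ξ : T) (z : E) :
    (1 + ‖z‖) * ballTransform F G ((x, ξ), toBall z) = F (x, ξ, z) := by
  have h : 0 < 1 + ‖z‖ := by positivity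
  have h1 := one_sub_norm_toBall z
  have h2 : ‖(toBall z : E)‖ < 1 := by
    rw [← sub_pos, h1]; positivity
  have h3 : (1 + ‖z‖) • (toBall z : E) = z := by
    rw [toBall, smul_smul, mul_inv_cancel₀ h.ne', one_smul]
  simp only [ballTransform, if_pos h2, h1, inv_inv, h3]
  rw [mul_inv_cancel_left₀ h.ne']

variable [MeasurableSpace E] [BorelSpace E]

lemma measurable_toBall : Measurable (toBall : E → Metric.closedBall (0 : E) 1) :=
  Measurable.subtype_mk ((measurable_const.add measurable_norm).inv.smul measurable_id)

lemma measurable_direction : Measurable (direction : E → Metric.closedBall (0 : E) 1) :=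
  Measurable.subtype_mk (measurable_norm.inv.smul measurable_id)

/-- The lift of the measure `a m + p s` to the compactified space, with the fast variable. -/
noncomputable def liftMeasure (ε : ℝ) (m s : Measure Ω) (a p : Ω → E) :
    Measure ((closure Ω × Torus d) × Metric.closedBall (0 : E) 1) :=
  (m.withDensity fun x => 1 + ‖a x‖ₑ).map (fun x => ((incl Ω x, fastVar ε x), toBall (a x))) +
  (s.withDensity fun x => ‖p x‖ₑ).map (fun x => ((incl Ω x, fastVar ε x), direction (p x)))

lemma measurable_incl : Measurable (incl Ω) := measurable_inclusion subset_closure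

variable {ε : ℝ} {m s : Measure Ω} {a p : Ω → E}

omit [NormedSpace ℝ E] [BorelSpace E] in
lemma measurable_lift {w : Ω → Metric.closedBall (0 : E) 1} (hw : Measurable w) :
    Measurable fun x => ((incl Ω x, fastVar ε (x : EuclideanSpace ℝ (Fin d))), w x) :=
  (measurable_incl.prodMk ((measurable_fastVar ε).comp measurable_subtype_coe)).prodMk hw

lemma liftMeasure_univ (ha : Measurable a) (hp : Measurable p) :
    liftMeasure ε m s a p univ = m univ + ∫⁻ x, ‖a x‖ₑ ∂m + ∫⁻ x, ‖p x‖ₑ ∂s := by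
  have h1 := measurable_lift (ε := ε) (w := fun x => toBall (a x)) (measurable_toBall.comp ha)
  have h2 := measurable_lift (ε := ε) (w := fun x => direction (p x)) (measurable_direction.comp hp)
  rw [liftMeasure, Measure.add_apply, Measure.map_apply h1 .univ, Measure.map_apply h2 .univ]
  simp only [preimage_univ, withDensity_apply _ MeasurableSet.univ, Measure.restrict_univ]
  rw [lintegral_add_left measurable_const, lintegral_one]

lemma integral_liftMeasure (ha : Measurable a) (hp : Measurable p)
    [IsFiniteMeasure (liftMeasure ε m s a p)]
    {H : (closure Ω × Torus d) × Metric.closedBall (0 : E) 1 → ℝ} (hH : Measurable H) {C : ℝ}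
    (hC : ∀ k, |H k| ≤ C) :
    ∫ k, H k ∂(liftMeasure ε m s a p) =
      ∫ x, (1 + ‖a x‖) * H ((incl Ω x, fastVar ε x), toBall (a x)) ∂m +
      ∫ x, ‖p x‖ * H ((incl Ω x, fastVar ε x), direction (p x)) ∂s := by
  have hi : Integrable H (liftMeasure ε m s a p) :=
    Integrable.of_bound hH.aestronglyMeasurable C (Eventually.of_forall hC)
  have h1 := measurable_lift (ε := ε) (w := fun x => toBall (a x)) (measurable_toBall.comp ha)
  have h2 := measurable_lift (ε := ε) (w := fun x => direction (p x)) (measurable_direction.comp hp)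
  obtain ⟨hi1, hi2⟩ := integrable_add_measure.1 hi
  rw [liftMeasure, integral_add_measure hi1 hi2]
  congr 1
  · refine (integral_map h1.aemeasurable hH.aestronglyMeasurable).trans ?_
    rw [integral_withDensity_eq_integral_toReal_smul (f := fun x => 1 + ‖a x‖ₑ) (by fun_prop)
        (Eventually.of_forall fun x => by simp)]
    simp [ENNReal.toReal_add]
  · refine (integral_map h2.aemeasurable hH.aestronglyMeasurable).trans ?_
    rw [integral_withDensity_eq_integral_toReal_smul hp.enorm (Eventually.of_forall fun x => by simp)]
    simp

end Lift

/-! ### Equidistribution on `Ω`. -/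

section Marginal

variable {d : ℕ} {Ω : Set (EuclideanSpace ℝ (Fin d))} (hΩ : IsOpen Ω)
  (hb : Bornology.IsBounded Ω)
  {ε : ℕ → ℝ} (hε_pos : ∀ n, 0 < ε n) (hε : Tendsto ε atTop (𝓝 0))

include hΩ hb hε_pos hε

lemma tendsto_integral_leb_mul_fastVar {φ : Ω → ℝ} (hφ : Measurable φ) {C : ℝ}
    (hC : ∀ x, |φ x| ≤ C) (g : C(Torus d, ℝ)) :
    Tendsto (fun n => ∫ x, φ x * g (fastVar (ε n) x) ∂(leb Ω)) atTop
      (𝓝 ((∫ x, φ x ∂(leb Ω)) * ∫ ξ, g ξ)) := by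
  let F : EuclideanSpace ℝ (Fin d) → ℝ := Function.extend Subtype.val φ 0
  have hF (x : Ω) : F x = φ x := Subtype.val_injective.extend_apply _ _ _
  have hF0 (x) (hx : x ∉ Ω) : F x = 0 :=
    Function.extend_apply' _ _ _ fun ⟨y, hy⟩ => hx (hy ▸ y.2)
  have hFm : Measurable F :=
    (MeasurableEmbedding.subtype_coe hΩ.measurableSet).measurable_extend hφ measurable_const
  have hFi : Integrable F := by
    refine IntegrableOn.integrable_of_forall_notMem_eq_zero (s := Ω) ?_ hF0
    have : IsFiniteMeasure (volume.restrict Ω) := ⟨by simpa using hb.measure_lt_top⟩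
    refine Integrable.of_bound hFm.aestronglyMeasurable C ?_
    filter_upwards [ae_restrict_mem hΩ.measurableSet] with x hx
    have := hC ⟨x, hx⟩
    rwa [← hF] at this
  have hsub (H : EuclideanSpace ℝ (Fin d) → ℝ) :
      ∫ x : Ω, φ x * H x ∂(leb Ω) = ∫ x, F x * H x := by
    rw [← setIntegral_eq_integral_of_forall_compl_eq_zero (s := Ω)
      fun x hx => by rw [hF0 x hx, zero_mul], ← integral_subtype_comap hΩ.measurableSet]
    simp only [hF]
    rfl
  have h := tendsto_integral_mul_fastVar_real hε_pos hε hFi g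
  have h1 := hsub 1
  simp only [Pi.one_apply, mul_one] at h1
  rw [h1]
  exact h.congr fun n => (hsub fun x => g (fastVar (ε n) x)).symm

end Marginal

/-! ### Uniform mass bound and the pairing written through the lift. -/

section Compactness

variable {d : ℕ} {Ω : Set (EuclideanSpace ℝ (Fin d))}
  {E : Type*} [NormedAddCommGroup E] [InnerProductSpace ℝ E]
  [FiniteDimensional ℝ E] [MeasurableSpace E] [BorelSpace E]

/-- The lift of a vector measure to the compactified space. -/
noncomputable def liftVectorMeasure (ε : ℝ) (μ : VectorMeasure Ω E) :
    Measure ((closure Ω × Torus d) × Metric.closedBall (0 : E) 1) :=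
  liftMeasure ε (leb Ω) (singularVariation μ (leb Ω)) (density μ (leb Ω)) (singularPolar μ (leb Ω))

lemma measurable_density {X : Type*} [MeasurableSpace X] (μ : VectorMeasure X E) (m : Measure X) :
    Measurable (density μ m) :=
  (stronglyMeasurable_density μ m).measurable

lemma measurable_singularPolar {X : Type*} [MeasurableSpace X] (μ : VectorMeasure X E)
    (m : Measure X) : Measurable (singularPolar μ m) :=
  measurable_density _ _

lemma integral_liftVectorMeasure {ε : ℝ} {μ : VectorMeasure Ω E}
    [h : IsFiniteMeasure (liftVectorMeasure ε μ)]
    {H : (closure Ω × Torus d) × Metric.closedBall (0 : E) 1 → ℝ} (hH : Measurable H) {C : ℝ}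
    (hC : ∀ k, |H k| ≤ C) :
    ∫ k, H k ∂(liftVectorMeasure ε μ) =
      ∫ x : Ω, (1 + ‖density μ (leb Ω) x‖) *
        H ((incl Ω x, fastVar ε x), toBall (density μ (leb Ω) x)) ∂(leb Ω) +
      ∫ x : Ω, ‖singularPolar μ (leb Ω) x‖ *
        H ((incl Ω x, fastVar ε x), direction (singularPolar μ (leb Ω) x))
        ∂(singularVariation μ (leb Ω)) :=
  have : IsFiniteMeasure (liftMeasure ε (leb Ω) (singularVariation μ (leb Ω))
    (density μ (leb Ω)) (singularPolar μ (leb Ω))) := h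
  integral_liftMeasure (measurable_density _ _) (measurable_singularPolar _ _) hH hC

omit [MeasurableSpace E] [BorelSpace E] in
lemma variation_singularPart_ne_top {μ : VectorMeasure Ω E} (hμ : μ.variation univ ≠ ∞) :
    (singularPart μ (leb Ω)).variation univ ≠ ∞ :=
  ne_top_of_le_ne_top (ENNReal.add_ne_top.2 ⟨hμ, ENNReal.mul_ne_top (by simp) hμ⟩)
    (singularVariation_univ_le hμ (leb Ω))

lemma liftVectorMeasure_univ_le (ε : ℝ) {μ : VectorMeasure Ω E} (hμ : μ.variation univ ≠ ∞) :
    liftVectorMeasure ε μ univ ≤ leb Ω univ + Module.finrank ℝ E * μ.variation univ +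
      Module.finrank ℝ E * (μ.variation univ + Module.finrank ℝ E * μ.variation univ) := by
  rw [liftVectorMeasure, liftMeasure_univ (measurable_density _ _) (measurable_singularPolar _ _)]
  gcongr
  · exact lintegral_enorm_density_le μ (leb Ω)
  · refine (lintegral_enorm_density_le (singularPart μ (leb Ω)) _).trans ?_
    gcongr
    exact singularVariation_univ_le hμ (leb Ω)

variable (hΩ : IsOpen Ω) (hb : Bornology.IsBounded Ω)
  {f : Ω × Torus d × E → ℝ} {finf : closure Ω × Torus d × E → ℝ}
  (hf : Continuous f) (hr : IsRecession f finf)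

include hΩ hb hf hr

lemma integrable_acIntegrand (ε : ℝ) {μ : VectorMeasure Ω E} (hμ : μ.variation univ ≠ ∞) :
    Integrable (acIntegrand f ε μ) (leb Ω) := by
  have hcpt : CompactSpace (closure Ω) := isCompact_iff_compactSpace.1 hb.isCompact_closure
  have hfin := isFiniteMeasure_leb hΩ.measurableSet hb
  obtain ⟨C, hC0, hC⟩ := (hr.isStrongRecession hΩ).exists_abs_le
  refine (((integrable_const 1).add (integrable_density hμ (leb Ω)).norm).const_mul C).mono' ?_
    (Eventually.of_forall fun x => ?_)
  · exact (hf.measurable.comp (measurable_id.prodMk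
      (((measurable_fastVar ε).comp measurable_subtype_coe).prodMk
        (stronglyMeasurable_density μ (leb Ω)).measurable))).aestronglyMeasurable
  · have := hC (incl Ω x) (fastVar ε x) (density μ (leb Ω) x)
    rwa [extendIntegrand_incl hΩ] at this

omit hf in
lemma integrable_singIntegrand (ε : ℝ) {μ : VectorMeasure Ω E} (hμ : μ.variation univ ≠ ∞) :
    Integrable (singIntegrand finf ε μ) (singularVariation μ (leb Ω)) := by
  have hcpt : CompactSpace (closure Ω) := isCompact_iff_compactSpace.1 hb.isCompact_closure
  obtain ⟨C, hC0, hC⟩ := (hr.isStrongRecession hΩ).exists_abs_le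
  refine ((integrable_density (variation_singularPart_ne_top hμ)
    (singularVariation μ (leb Ω))).norm.const_mul C).mono' ?_ (Eventually.of_forall fun x => ?_)
  · exact (hr.continuous.measurable.comp (measurable_incl.prodMk
      (((measurable_fastVar ε).comp measurable_subtype_coe).prodMk
        (stronglyMeasurable_density _ _).measurable))).aestronglyMeasurable
  · exact (hr.isStrongRecession hΩ).abs_le hC _ _ _

/-- This makes the nonlinear expression in `μ` linear in its lift. The weight `|p|` on the singular
part is absorbed by homogeneity of `finf`, so `|p| = 1` need not be known. -/
lemma integral_composition (ε : ℝ) {μ : VectorMeasure Ω E} (hμ : μ.variation univ ≠ ∞)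
    [IsFiniteMeasure (liftVectorMeasure ε μ)] (φ : C(closure Ω, ℝ)) :
    ∫ᵛ x, φ x ∂•(composition f finf ε μ) =
      ∫ k, φ k.1.1 * ballTransform (extendIntegrand f finf) finf k ∂(liftVectorMeasure ε μ) := by
  have hcpt : CompactSpace (closure Ω) := isCompact_iff_compactSpace.1 hb.isCompact_closure
  have hs := hr.isStrongRecession hΩ
  obtain ⟨C, hC0, hC⟩ := hs.exists_abs_le
  have hm : Measurable (ballTransform (extendIntegrand f finf) finf) :=
    measurable_ballTransform (measurable_extendIntegrand hΩ hf hr.continuous)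
      hr.continuous.measurable
  rw [composition, integral_map_withDensityᵥ_add (C := ‖φ‖)
    (integrable_acIntegrand hΩ hb hf hr ε hμ) (integrable_singIntegrand hΩ hb hr ε hμ)
    measurable_incl φ.continuous.measurable φ.norm_coe_le_norm,
    integral_liftVectorMeasure (C := ‖φ‖ * C) (by fun_prop) ?_]
  · congr 1
    · refine integral_congr_ae (Eventually.of_forall fun x => ?_)
      dsimp only
      rw [mul_left_comm, ballTransform_toBall, extendIntegrand_incl hΩ, acIntegrand]
    · refine integral_congr_ae (Eventually.of_forall fun x => ?_)
      simp only [singIntegrand]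
      rw [mul_left_comm]
      congr 1
      -- Where `p = 0` the direction is a default value, but both the weight and `finf` vanish.
      by_cases hp : singularPolar μ (leb Ω) x = 0
      · rw [hp, hr.zero, norm_zero, zero_mul]
      · have h1 := norm_direction hp
        simp only [ballTransform, h1, lt_irrefl, if_false]
        rw [← hr.smul (norm_pos_iff.2 hp), direction, smul_smul,
          mul_inv_cancel₀ (norm_ne_zero_iff.2 hp), one_smul]
  · intro k
    rw [abs_mul]
    exact mul_le_mul (φ.norm_coe_le_norm _) (abs_ballTransform_le hs hC0 hC k) (abs_nonneg _)
      (norm_nonneg _)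

end Compactness

/-! ### Passage to the limit. -/

section Limit

variable {d : ℕ} {Ω : Set (EuclideanSpace ℝ (Fin d))}
  {E : Type*} [NormedAddCommGroup E] [InnerProductSpace ℝ E]
  [FiniteDimensional ℝ E] [MeasurableSpace E] [BorelSpace E]
  (hΩ : IsOpen Ω) (hb : Bornology.IsBounded Ω) (hbdry : volume (frontier Ω) = 0)
  {ε : ℕ → ℝ} (hε_pos : ∀ n, 0 < ε n) (hε : Tendsto ε atTop (𝓝 0))
  {μ : ℕ → VectorMeasure Ω E}
  [∀ n, IsFiniteMeasure (liftVectorMeasure (ε n) (μ n))]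
  {θ : Measure ((closure Ω × Torus d) × Metric.closedBall (0 : E) 1)} [IsFiniteMeasure θ]
  (hθ : ∀ φ : C((closure Ω × Torus d) × Metric.closedBall (0 : E) 1, ℝ),
    Tendsto (fun n => ∫ x, φ x ∂(liftVectorMeasure (ε n) (μ n))) atTop (𝓝 (∫ x, φ x ∂θ)))

include hΩ hb hbdry hε_pos hε hθ

/-- Test `θ` with `(1 - |w|) φ(x) g(ξ)`, which is continuous. On the lifts the singular term drops
out and the weight cancels `1 + |a|`, leaving `∫ φ(x) g(x/ε) dx`, which tends to `∫ φ · ∫ g`. -/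
lemma fst_oscMeasure_eq_prod : (oscMeasure θ).fst = (leb (closure Ω)).prod volume := by
  have hfin := isFiniteMeasure_leb hΩ.measurableSet hb
  have hfin' := isFiniteMeasure_leb isClosed_closure.measurableSet hb.closure
  refine Measure.eq_prod_of_integral_mul_boundedContinuousFunction fun φ g => ?_
  have h1 : Continuous fun k : (closure Ω × Torus d) × Metric.closedBall (0 : E) 1 =>
    (1 - ‖(k.2 : E)‖) * (φ k.1.1 * g k.1.2) := by fun_prop
  have h2 := hθ ⟨_, h1⟩
  simp only [ContinuousMap.coe_mk] at h2
  rw [integral_fst_oscMeasure θ (fun p => φ p.1 * g p.2) (by fun_prop)]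
  have h3 := tendsto_integral_leb_mul_fastVar hΩ hb hε_pos hε (φ := fun x => φ (incl Ω x))
    (φ.continuous.measurable.comp measurable_incl) (fun x => φ.norm_coe_le_norm _) g.toContinuousMap
  rw [← map_incl_leb hΩ hbdry, integral_map measurable_incl.aemeasurable
    φ.continuous.aestronglyMeasurable]
  refine tendsto_nhds_unique h2 (h3.congr fun n => ?_)
  rw [integral_liftVectorMeasure (C := ‖φ‖ * ‖g‖) h1.measurable ?_]
  · have h4 (x : Ω) : ‖singularPolar (μ n) (leb Ω) x‖ *
        ((1 - ‖(direction (singularPolar (μ n) (leb Ω) x) : E)‖) *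
          (φ (incl Ω x) * g (fastVar (ε n) (x : EuclideanSpace ℝ (Fin d))))) = 0 := by
      by_cases hp : singularPolar (μ n) (leb Ω) x = 0
      · simp [hp]
      · simp [norm_direction hp]
    simp only [h4, integral_zero, add_zero, one_sub_norm_toBall]
    refine integral_congr_ae (Eventually.of_forall fun x => ?_)
    have : (1 + ‖density (μ n) (leb Ω) x‖) ≠ 0 := by positivity
    simp only [mul_inv_cancel_left₀ this]
    rfl
  · intro k
    have hk := mem_closedBall_zero_iff.1 k.2.2
    have hk0 := norm_nonneg (k.2 : E)
    rw [abs_mul, abs_mul, abs_of_nonneg (sub_nonneg.2 hk)]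
    refine (mul_le_of_le_one_left (by positivity) (by linarith)).trans ?_
    exact mul_le_mul (φ.norm_coe_le_norm _) (g.norm_coe_le_norm _) (abs_nonneg _) (norm_nonneg _)

/-- The first marginal does not charge the boundary, and the weight `1 - |w|` is positive inside the
ball, so `θ` has no mass there. -/
lemma ae_mem_or_norm_eq_one :
    ∀ᵐ k ∂θ, k.1.1 ∈ range (incl Ω) ∨ ‖(k.2 : E)‖ = 1 := by
  have h := fst_oscMeasure_eq_prod hΩ hb hbdry hε_pos hε hθ
  have hfin' := isFiniteMeasure_leb isClosed_closure.measurableSet hb.closure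
  have hN : MeasurableSet (range (incl Ω))ᶜ := (measurableEmbedding_incl hΩ).measurableSet_range.compl
  have h0 : leb (closure Ω) (range (incl Ω))ᶜ = 0 := by
    rw [← map_incl_leb hΩ hbdry, Measure.map_apply measurable_incl hN]
    simp
  have h1 : (oscMeasure θ).fst ((range (incl Ω))ᶜ ×ˢ univ) = 0 := by
    rw [h, Measure.prod_prod, h0, zero_mul]
  rw [Measure.fst_apply (hN.prod .univ), oscMeasure,
    Measure.map_apply measurable_dilate (measurable_fst (hN.prod .univ)),
    withDensity_apply_eq_zero measurable_one_sub_norm.ennreal_ofReal] at h1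
  refine measure_mono_null (fun k hk => ?_) h1
  obtain ⟨hk1, hk2⟩ := not_or.1 hk
  refine ⟨?_, hk1, trivial⟩
  have := lt_of_le_of_ne (mem_closedBall_zero_iff.1 k.2.2) hk2
  simpa using this

lemma tendsto_integral_mul_ballTransform {f : Ω × Torus d × E → ℝ}
    {finf : closure Ω × Torus d × E → ℝ} (hf : Continuous f) (hr : IsRecession f finf)
    (φ : C(closure Ω, ℝ)) :
    Tendsto (fun n => ∫ k, φ k.1.1 * ballTransform (extendIntegrand f finf) finf k
      ∂(liftVectorMeasure (ε n) (μ n))) atTop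
      (𝓝 (∫ k, φ k.1.1 * ballTransform (extendIntegrand f finf) finf k ∂θ)) := by
  have hcpt : CompactSpace (closure Ω) := isCompact_iff_compactSpace.1 hb.isCompact_closure
  have hs := hr.isStrongRecession hΩ
  obtain ⟨C, hC0, hC⟩ := hs.exists_abs_le
  have hm : Measurable (ballTransform (extendIntegrand f finf) finf) :=
    measurable_ballTransform (measurable_extendIntegrand hΩ hf hr.continuous)
      hr.continuous.measurable
  refine tendsto_integral_of_ae_continuousAt hθ (by fun_prop) (C := ‖φ‖ * C) (fun k => ?_) ?_
  · rw [abs_mul]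
    exact mul_le_mul (φ.norm_coe_le_norm _) (abs_ballTransform_le hs hC0 hC k) (abs_nonneg _)
      (norm_nonneg _)
  · filter_upwards [ae_mem_or_norm_eq_one hΩ hb hbdry hε_pos hε hθ] with k hk
    refine ContinuousAt.mul (by fun_prop) ?_
    by_cases hk1 : ‖(k.2 : E)‖ = 1
    · exact hs.continuousAt_ballTransform_of_norm_eq hk1
    · obtain ⟨x, hx⟩ := hk.resolve_right hk1
      refine continuousAt_ballTransform_of_norm_lt
        (lt_of_le_of_ne (mem_closedBall_zero_iff.1 k.2.2) hk1) fun z => ?_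
      rw [← hx]
      exact continuousAt_extendIntegrand hΩ hf x _ z

end Limit

end TwoScale

/-! ### Assembly of the theorem. -/

theorem theorem1p1 {d : ℕ} {E : Type*} [NormedAddCommGroup E] [InnerProductSpace ℝ E]
    [FiniteDimensional ℝ E] [Nontrivial E] [MeasurableSpace E] [BorelSpace E]
    (Ω : Set (EuclideanSpace ℝ (Fin d))) (hΩ_open : IsOpen Ω)
    (hΩ_bdd : Bornology.IsBounded Ω) (hΩ_bdry : volume (frontier Ω) = 0)
    (ε : ℕ → ℝ) (hε_pos : ∀ n, 0 < ε n) (hε : Tendsto ε atTop (𝓝 0))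
    (μ : ℕ → VectorMeasure Ω E) (hμ : (⨆ n, (μ n).variation univ) < ∞) :
    ∃ (k : ℕ → ℕ) (Y : TwoScale.YoungMeasure Ω E), StrictMono k ∧
      ∀ (f : Ω × TwoScale.Torus d × E → ℝ) (finf : closure Ω × TwoScale.Torus d × E → ℝ),
        Continuous f → TwoScale.IsRecession f finf →
          (∀ n, Integrable (TwoScale.acIntegrand f (ε (k n)) (μ (k n)))
              (TwoScale.leb Ω) ∧
            Integrable (TwoScale.singIntegrand finf (ε (k n)) (μ (k n)))
              (TwoScale.singularVariation (μ (k n)) (TwoScale.leb Ω))) ∧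
          TwoScale.PairingIntegrable Y f finf ∧
          ∃ μf : SignedMeasure (closure Ω),
            (∀ ω : Set (closure Ω), MeasurableSet ω →
              μf ω = TwoScale.oscPart Y f ω + TwoScale.concPart Y finf ω) ∧
            TwoScale.WeakStarTendsto
              (fun n => TwoScale.composition f finf (ε (k n)) (μ (k n))) μf := by
  have hcpt : CompactSpace (closure Ω) := isCompact_iff_compactSpace.1 hΩ_bdd.isCompact_closure
  have hproper : ProperSpace E := FiniteDimensional.proper_real E
  have hfin := TwoScale.isFiniteMeasure_leb hΩ_open.measurableSet hΩ_bdd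
  set M := ⨆ n, (μ n).variation univ
  have hM (n : ℕ) : (μ n).variation univ ≤ M := le_iSup (fun n => (μ n).variation univ) n
  have hμn (n : ℕ) : (μ n).variation univ ≠ ∞ := ne_top_of_le_ne_top hμ.ne (hM n)
  -- The bound of `liftVectorMeasure_univ_le` with every variation replaced by the supremum `M`.
  set C := TwoScale.leb Ω univ + Module.finrank ℝ E * M +
    Module.finrank ℝ E * (M + Module.finrank ℝ E * M)
  have hCtop : C ≠ ∞ := by
    have h1 : (Module.finrank ℝ E : ℝ≥0∞) ≠ ∞ := by simp
    have h2 := hμ.ne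
    have h3 := measure_ne_top (TwoScale.leb Ω) univ
    finiteness
  have hmass (n : ℕ) : TwoScale.liftVectorMeasure (ε n) (μ n) univ ≤ C := by
    refine (TwoScale.liftVectorMeasure_univ_le (ε n) (hμn n)).trans ?_
    simp only [C]
    gcongr <;> exact hM n
  have hlift (n : ℕ) : IsFiniteMeasure (TwoScale.liftVectorMeasure (ε n) (μ n)) :=
    ⟨(hmass n).trans_lt hCtop.lt_top⟩
  obtain ⟨k, θ, hk, hθfin, hθ⟩ := TwoScale.exists_subseq_tendsto_integral
    (fun n => TwoScale.liftVectorMeasure (ε n) (μ n)) (C := C.toReal)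
    fun n => ENNReal.toReal_mono hCtop (hmass n)
  have hε_pos' (n : ℕ) : 0 < ε (k n) := hε_pos _
  have hε' : Tendsto (fun n => ε (k n)) atTop (𝓝 0) := hε.comp hk.tendsto_atTop
  have hosc := TwoScale.fst_oscMeasure_eq_prod hΩ_open hΩ_bdd hΩ_bdry hε_pos' hε' hθ
  refine ⟨k, TwoScale.youngMeasureOf θ hosc, hk, fun f finf hf hr => ⟨fun n =>
    ⟨TwoScale.integrable_acIntegrand hΩ_open hΩ_bdd hf hr _ (hμn _),
      TwoScale.integrable_singIntegrand hΩ_open hΩ_bdd hr _ (hμn _)⟩,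
    TwoScale.pairingIntegrable_youngMeasureOf hΩ_open hΩ_bdd hΩ_bdry hosc hf hr,
    -- The limit measure is the projection to `closure Ω` of `θ` with density `Tf`.
    (θ.withDensityᵥ (TwoScale.ballTransform (TwoScale.extendIntegrand f finf) finf)).map
      (fun q => q.1.1), ?_⟩⟩
  have hs := hr.isStrongRecession hΩ_open
  obtain ⟨K, hK0, hK⟩ := hs.exists_abs_le
  have hi : Integrable (TwoScale.ballTransform (TwoScale.extendIntegrand f finf) finf) θ :=
    Integrable.of_bound (TwoScale.measurable_ballTransform
      (TwoScale.measurable_extendIntegrand hΩ_open hf hr.continuous)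
      hr.continuous.measurable).aestronglyMeasurable K
      (Eventually.of_forall (TwoScale.abs_ballTransform_le hs hK0 hK))
  have hproj : Measurable fun q : (closure Ω × TwoScale.Torus d) × Metric.closedBall (0 : E) 1 =>
    q.1.1 := measurable_fst.fst
  refine ⟨fun ω hω => ?_, fun φ => ?_⟩
  · rw [VectorMeasure.map_apply _ hproj hω, withDensityᵥ_apply hi (hproj hω),
      ← TwoScale.setIntegral_ballTransform_eq hΩ_open hΩ_bdd hΩ_bdry hosc hf hr hω]
    congr 2
    ext
    simp
  · rw [TwoScale.integral_map_withDensityᵥ hi hproj φ.continuous.measurable φ.norm_coe_le_norm]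
    simp only [TwoScale.integral_composition hΩ_open hΩ_bdd hf hr _ (hμn _)]
    exact TwoScale.tendsto_integral_mul_ballTransform hΩ_open hΩ_bdd hΩ_bdry hε_pos' hε' hθ hf hr φ
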